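/- Let $X=\mathbb P^2$ be the complex projective plane with homogeneous coordinates $[x_0:x_1:x_2]$, let $T=(\mathbb C^*)^3/\mathbb C^*$ be the torus acting on it by $t\cdot[x_0:x_1:x_2]=[t_0x_0:t_1x_1:t_2x_2]$, let $D_i=\{x_i=0\}$ for $i=0,1,2$, and let $K_X$ be a canonical divisor of $X$ (the divisor of a nonzero rational $2$-form; such divisors exist). (1) Let $D\neq 0$ be a reduced effective divisor on $X$. Then $(X,D)$ is a log smooth toric del Pezzo pair, that is, $D$ is a simple normal crossing divisor, $D$ is $T$-invariant and $-(K_X+D)$ is ample, if and only if $$D\in\{D_0,\,D_1,\,D_2\}\cup\{D_0+D_1,\;D_0+D_2,\;D_1+D_2\}.$$ (2) For every reduced effective $T$-invariant divisor $D$ on $X$ (possibly $D=0$), the divisor $-(K_X+D)$ fails to be ample if and only if $D=D_0+D_1+D_2$. -/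

import Mathlib

open AlgebraicGeometry CategoryTheory MvPolynomial

noncomputable section

/-! ### Divisors on an integral locally Noetherian scheme -/

section Divisors

universe u

/-- A prime divisor of `X`, given by its generic point: a point of codimension one.
(In the specialization order of a scheme, the coheight of a point is its codimension.) -/
def PrimeDivisor (X : Scheme.{u}) : Type u := {x : X // Order.coheight x = 1}

/-- Weil divisors: the free abelian group on the prime divisors. -/
abbrev WeilDivisor (X : Scheme.{u}) : Type u := PrimeDivisor X →₀ ℤ

variable {X : Scheme.{u}}

/-- A reduced (effective) divisor: a sum of distinct prime divisors. -/
def IsReducedDivisor (D : WeilDivisor X) : Prop := ∀ P, D P = 0 ∨ D P = 1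

/-- `D` is invariant under the automorphism `φ`: prime divisors that correspond to each other
under `φ` have the same coefficient in `D`. -/
def IsInvariantUnder (φ : X ⟶ X) (D : WeilDivisor X) : Prop :=
  ∀ P Q : PrimeDivisor X, φ P.1 = Q.1 → D P = D Q

variable [IsIntegral X] [IsLocallyNoetherian X]

/-- `f` is a nonzero global section of `𝒪_X(D)`, i.e. `f ≠ 0` and `div f + D ≥ 0`. -/
def IsSectionOf (f : X.functionField) (D : WeilDivisor X) : Prop :=
  f ≠ 0 ∧ ∀ P : PrimeDivisor X, 0 ≤ X.ord f P.1 + D P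

/-- The non-vanishing locus `X_f` of the section `f` of `𝒪_X(D)`: the complement of the support of
the effective divisor `div f + D`. -/
def nonVanishingLocus (f : X.functionField) (D : WeilDivisor X) : Set X :=
  {y | ∀ P : PrimeDivisor X, X.ord f P.1 + D P ≠ 0 → ¬ P.1 ⤳ y}

/-- `D` is ample (on a quasi-compact locally factorial `X`, where every Weil divisor is Cartier):
the open sets `X_f` that are affine, for `f` a section of a positive multiple `nD`, cover `X`.
This is the usual definition of ampleness for the invertible sheaf `𝒪_X(D)`. -/
def IsAmpleDivisor (D : WeilDivisor X) : Prop :=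
  ∀ x : X, ∃ n : ℕ, 1 ≤ n ∧ ∃ f : X.functionField, IsSectionOf f (n • D) ∧
    ∃ U : X.Opens, IsAffineOpen U ∧ (U : Set X) = nonVanishingLocus f (n • D) ∧ x ∈ U

/-- `D` is a simple normal crossing divisor: at each point `y` of its support there is a regular
system of parameters `r` of the local ring such that, near `y`, the divisor `D` is the zero divisor
of the product of some of the members of `r`. -/
def IsSNCDivisor (D : WeilDivisor X) : Prop :=
  ∀ y : X, (∃ P : PrimeDivisor X, D P ≠ 0 ∧ P.1 ⤳ y) →
    ∃ (d : ℕ) (r : Fin d → X.presheaf.stalk y) (S : Finset (Fin d)),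
      ringKrullDim (X.presheaf.stalk y) = d ∧
      Ideal.span (Set.range r) = IsLocalRing.maximalIdeal (X.presheaf.stalk y) ∧
      ∀ P : PrimeDivisor X, P.1 ⤳ y →
        D P = X.ord (algebraMap (X.presheaf.stalk y) X.functionField (∏ i ∈ S, r i)) P.1

end Divisors

/-! ### The canonical divisor of a smooth complex surface -/

section Canonical

variable {X : Scheme.{0}} [X.Over (Spec (.of ℂ))]

/-- The local rings (in particular the function field) of a complex scheme are `ℂ`-algebras. -/
instance stalkComplexAlgebra (x : X) : Algebra ℂ (X.presheaf.stalk x) :=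
  ((X.presheaf.germ ⊤ x trivial).hom.comp
    ((X ↘ Spec (.of ℂ)).appTop.hom.comp (Scheme.ΓSpecIso (.of ℂ)).inv.hom)).toAlgebra

open scoped KaehlerDifferential in
/-- `K` is a canonical divisor of the smooth surface `X`: the divisor of a nonzero rational
2-form `ω`. At a prime divisor `P`, write `ω = f du₀ ∧ du₁` where `du₀, du₁` is a basis of the
module of differentials of the local ring at `P`; then the coefficient of `K` at `P` is the order
of `f` along `P`. -/
def IsCanonicalDivisor [IsIntegral X] [IsLocallyNoetherian X] (K : WeilDivisor X) : Prop :=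
  ∃ ω : ⋀[X.functionField]^2 Ω[X.functionField⁄ℂ], ω ≠ 0 ∧
    ∀ P : PrimeDivisor X, ∃ (u : Fin 2 → X.presheaf.stalk P.1) (f : X.functionField),
      LinearIndependent (X.presheaf.stalk P.1)
        (fun i => KaehlerDifferential.D ℂ (X.presheaf.stalk P.1) (u i)) ∧
      Submodule.span (X.presheaf.stalk P.1)
        (Set.range fun i => KaehlerDifferential.D ℂ (X.presheaf.stalk P.1) (u i)) = ⊤ ∧
      ω = f • exteriorPower.ιMulti X.functionField 2 (fun i =>
        KaehlerDifferential.D ℂ X.functionField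
          (algebraMap (X.presheaf.stalk P.1) X.functionField (u i))) ∧
      K P = X.ord f P.1

end Canonical

/-! ### The projective plane over `ℂ` -/

/-- The grading of `ℂ[x₀, x₁, x₂]` by degree. -/
abbrev polyGrading : ℕ → Submodule ℂ (MvPolynomial (Fin 3) ℂ) := homogeneousSubmodule (Fin 3) ℂ

instance polyGradedAlgebra : GradedAlgebra polyGrading := MvPolynomial.gradedAlgebra

/-- The complex projective plane `ℙ² = Proj ℂ[x₀, x₁, x₂]`. -/
abbrev P2 : Scheme.{0} := Proj polyGrading

/-- The structure morphism `ℙ² ⟶ Spec ℂ`. -/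
instance P2.over : P2.Over (Spec (.of ℂ)) :=
  ⟨Proj.toSpecZero polyGrading ≫
    Spec.map (CommRingCat.ofHom (algebraMap ℂ (polyGrading 0)))⟩

/-- The generic point of `ℙ²`: the zero ideal. -/
def P2.zeroPoint : P2 where
  asHomogeneousIdeal := ⊥
  isPrime := by
    rw [HomogeneousIdeal.toIdeal_bot]
    exact Ideal.isPrime_bot
  not_irrelevant_le h := by
    have h1 : (X 0 : MvPolynomial (Fin 3) ℂ) ∈ HomogeneousIdeal.irrelevant polyGrading :=
      HomogeneousIdeal.mem_irrelevant_of_mem polyGrading one_pos (isHomogeneous_X ℂ 0)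
    have h2 : (X 0 : MvPolynomial (Fin 3) ℂ) ∈ (⊥ : Ideal (MvPolynomial (Fin 3) ℂ)) := h h1
    exact X_ne_zero (R := ℂ) (0 : Fin 3) h2

lemma P2.specializes_iff (x y : P2) :
    x ⤳ y ↔ x.asHomogeneousIdeal ≤ y.asHomogeneousIdeal := by
  rw [specializes_iff_mem_closure]
  exact (ProjectiveSpectrum.le_iff_mem_closure polyGrading x y).symm

instance P2.isIntegral : IsIntegral P2 := by
  have h1 : IrreducibleSpace P2 := by
    have hc : closure {P2.zeroPoint} = (Set.univ : Set P2) := by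
      refine Set.eq_univ_of_forall fun x => ?_
      rw [← specializes_iff_mem_closure, P2.specializes_iff]
      exact bot_le
    have h : IsIrreducible (Set.univ : Set P2) := hc ▸ isIrreducible_singleton.closure
    have : PreirreducibleSpace P2 := ⟨h.2⟩
    exact ⟨⟨P2.zeroPoint⟩⟩
  have h2 : ∀ x : P2, _root_.IsReduced (P2.presheaf.stalk x) := by
    intro x
    have hp : x.asHomogeneousIdeal.toIdeal.IsPrime := x.isPrime
    have hr : _root_.IsReduced
        (HomogeneousLocalization.AtPrime polyGrading x.asHomogeneousIdeal.toIdeal) :=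
      isReduced_of_injective
        (algebraMap _ (Localization.AtPrime x.asHomogeneousIdeal.toIdeal))
        (HomogeneousLocalization.val_injective _)
    exact isReduced_of_injective (Proj.stalkIso polyGrading x).commRingCatIsoToRingEquiv
      (Proj.stalkIso polyGrading x).commRingCatIsoToRingEquiv.injective
  have h3 : AlgebraicGeometry.IsReduced P2 := isReduced_of_isReduced_stalk P2
  exact isIntegral_of_irreducibleSpace_of_isReduced P2

instance P2.isLocallyNoetherian : IsLocallyNoetherian P2 := by
  have : IsScalarTower ℂ (polyGrading 0) (MvPolynomial (Fin 3) ℂ) :=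
    ⟨fun a b c => smul_mul_assoc a (b : MvPolynomial (Fin 3) ℂ) c⟩
  have : Algebra.FiniteType (polyGrading 0) (MvPolynomial (Fin 3) ℂ) :=
    Algebra.FiniteType.of_restrictScalars_finiteType ℂ (polyGrading 0) _
  rw [isLocallyNoetherian_iff_openCover (Proj.affineOpenCover polyGrading).openCover]
  intro i
  have : Algebra.FiniteType (polyGrading 0) (HomogeneousLocalization.Away polyGrading i.2.1) :=
    HomogeneousLocalization.Away.finiteType i.2.1 i.1 i.2.2
  have : IsNoetherianRing (HomogeneousLocalization.Away polyGrading i.2.1) :=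
    Algebra.FiniteType.isNoetherianRing (polyGrading 0) _
  exact inferInstanceAs (IsLocallyNoetherian
    (Spec (.of (HomogeneousLocalization.Away polyGrading i.2.1))))

/-- The graded automorphism `xᵢ ↦ tᵢ xᵢ` of `ℂ[x₀, x₁, x₂]`. -/
def torusGradedHom (t : Fin 3 → ℂˣ) : polyGrading →+*ᵍ polyGrading where
  __ := (aeval (fun i => C (t i : ℂ) * X i) :
    MvPolynomial (Fin 3) ℂ →ₐ[ℂ] MvPolynomial (Fin 3) ℂ).toRingHom
  map_mem {n p} hp := by
    have h := IsHomogeneous.aeval (R := ℂ) hp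
      (fun i : Fin 3 => (C (t i : ℂ) * X i : MvPolynomial (Fin 3) ℂ)) (n := 1)
      (fun i => by simpa using (isHomogeneous_C (Fin 3) (t i : ℂ)).mul (isHomogeneous_X ℂ i))
    rw [one_mul] at h
    exact h

lemma torusGradedHom_inv (t : Fin 3 → ℂˣ) (p : MvPolynomial (Fin 3) ℂ) :
    torusGradedHom t (torusGradedHom t⁻¹ p) = p := by
  have h : ((aeval (fun i => C (t i : ℂ) * X i) :
      MvPolynomial (Fin 3) ℂ →ₐ[ℂ] MvPolynomial (Fin 3) ℂ).comp
      (aeval (fun i => C ((t⁻¹ : Fin 3 → ℂˣ) i : ℂ) * X i))) = AlgHom.id ℂ _ := by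
    ext1 i
    simp [← mul_assoc, ← C_mul]
  exact DFunLike.congr_fun h p

lemma torusGradedHom_irrelevant (t : Fin 3 → ℂˣ) :
    HomogeneousIdeal.irrelevant polyGrading ≤
      (HomogeneousIdeal.irrelevant polyGrading).map (torusGradedHom t) := by
  rw [HomogeneousIdeal.irrelevant_le]
  intro i hi p hp
  have h : torusGradedHom t⁻¹ p ∈ HomogeneousIdeal.irrelevant polyGrading :=
    HomogeneousIdeal.mem_irrelevant_of_mem polyGrading hi ((torusGradedHom t⁻¹).map_mem hp)
  have h2 := Ideal.mem_map_of_mem (torusGradedHom t) h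
  rw [torusGradedHom_inv] at h2
  exact h2

/-- The action on `ℙ²` of the torus `T = (ℂˣ)³ / ℂˣ`:
`t • [x₀ : x₁ : x₂] = [t₀ x₀ : t₁ x₁ : t₂ x₂]`. -/
def torusAction (t : Fin 3 → ℂˣ) : P2 ⟶ P2 :=
  Proj.map (torusGradedHom t) (torusGradedHom_irrelevant t)

/-- `D` is invariant under the action of the torus. -/
def IsTorusInvariant (D : WeilDivisor P2) : Prop :=
  ∀ t : Fin 3 → ℂˣ, IsInvariantUnder (torusAction t) D

/-- The generic point of the coordinate line `xᵢ = 0`, i.e. the homogeneous prime ideal `(xᵢ)`. -/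
def coordPoint (i : Fin 3) : P2 where
  asHomogeneousIdeal := ⟨Ideal.span {X i}, Ideal.homogeneous_span _ _ fun x hx => by
    rw [Set.mem_singleton_iff] at hx
    exact ⟨1, hx ▸ isHomogeneous_X ℂ i⟩⟩
  isPrime := (Ideal.span_singleton_prime (X_ne_zero i)).mpr (X_prime (i := i))
  not_irrelevant_le h := by
    obtain ⟨j, hj⟩ := exists_ne i
    have h1 : (X j : MvPolynomial (Fin 3) ℂ) ∈ HomogeneousIdeal.irrelevant polyGrading :=
      HomogeneousIdeal.mem_irrelevant_of_mem polyGrading one_pos (isHomogeneous_X ℂ j)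
    have h2 : (X j : MvPolynomial (Fin 3) ℂ) ∈ Ideal.span {(X i : MvPolynomial (Fin 3) ℂ)} := h h1
    rw [Ideal.mem_span_singleton, X_dvd_X] at h2
    exact hj h2.symm

lemma coheight_coordPoint (i : Fin 3) : Order.coheight (coordPoint i) = 1 := by
  have hX : (X i : MvPolynomial (Fin 3) ℂ) ≠ 0 := X_ne_zero i
  apply le_antisymm
  · refine Order.coheight_le_coe_iff (n := 1) |>.mpr fun y hy => ?_
    have h1 : y ⤳ coordPoint i := hy.1
    have h2 : ¬ coordPoint i ⤳ y := hy.2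
    rw [P2.specializes_iff] at h1 h2
    have hXy : (X i : MvPolynomial (Fin 3) ℂ) ∉ y.asHomogeneousIdeal.toIdeal := fun h =>
      h2 ((Ideal.span_singleton_le_iff_mem _).mpr h)
    have hle : y.asHomogeneousIdeal.toIdeal ≤ Ideal.span {X i} := h1
    -- a prime ideal strictly contained in `(xᵢ)` is zero
    have hpow : ∀ p ∈ y.asHomogeneousIdeal.toIdeal, p = 0 := by
      intro p hp
      by_contra hp0
      obtain ⟨n, q, hq, rfl⟩ := WfDvdMonoid.max_power_factor hp0 (X_prime (i := i)).irreducible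
      have hq' : q ∈ y.asHomogeneousIdeal.toIdeal := by
        rcases y.isPrime.mem_or_mem hp with h | h
        · exact absurd (y.isPrime.mem_of_pow_mem n h) hXy
        · exact h
      exact hq (Ideal.mem_span_singleton.mp (hle hq'))
    have h0 : Order.coheight y = 0 := by
      rw [Order.coheight_eq_zero]
      intro z hz
      change y ⤳ z
      rw [P2.specializes_iff]
      intro p hp
      have hp0 : p = 0 := hpow p hp
      rw [hp0]
      exact Ideal.zero_mem z.asHomogeneousIdeal.toIdeal
    rw [h0]
    exact_mod_cast zero_lt_one
  · rw [Order.one_le_iff_ne_zero, Order.coheight_ne_zero]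
    intro h
    have h1 : P2.zeroPoint ⤳ coordPoint i := by
      rw [P2.specializes_iff]
      exact bot_le
    have h2 : coordPoint i ⤳ P2.zeroPoint := h h1
    rw [P2.specializes_iff] at h2
    have h3 : (X i : MvPolynomial (Fin 3) ℂ) ∈ (⊥ : Ideal (MvPolynomial (Fin 3) ℂ)) :=
      h2 (Ideal.mem_span_singleton_self (X i))
    exact hX h3

/-- The divisor `Dᵢ` of `ℙ²`: the coordinate line `xᵢ = 0`. -/
def coordLine (i : Fin 3) : WeilDivisor P2 :=
  Finsupp.single (⟨coordPoint i, coheight_coordPoint i⟩ : PrimeDivisor P2) 1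

/-- Given a canonical divisor `K` of `ℙ²`, the pair `(ℙ², D)` is a log smooth toric del Pezzo pair:
`D` is a simple normal crossing divisor, invariant under the torus, and `-(K + D)` is ample. -/
def IsToricLogDelPezzo (K D : WeilDivisor P2) : Prop :=
  IsSNCDivisor D ∧ IsTorusInvariant D ∧ IsAmpleDivisor (-(K + D))

end

/-!
# Log smooth toric del Pezzo pairs on the projective plane

All local rings of `ℙ²` and its function field are embedded in `ℂ(x₀, x₁, x₂)` (`P2.toRatFun`), as
fractions of homogeneous polynomials of the same degree. A prime divisor is a curve `p = 0` with `p` a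
homogeneous prime (`PrimeDivisor.exists_prime`), and the order of `a / b` along it is the difference of
the multiplicities of `p` in `a` and in `b` (`ord_eq_multiplicity_sub`).

Three computations give the theorem.

* A torus invariant divisor is supported on the coordinate lines
  (`eq_coordPoint_of_isTorusInvariant`): a prime `p` that is not a coordinate has two different
  monomials, hence infinitely many translates `p(t x)` up to scalars. So a reduced torus invariant
  divisor is `∑ i ∈ S, Dᵢ` for a set `S` of indices, and all of these have simple normal crossings
  (`isSNCDivisor_sum_coordLine`).
* The 2-form `d(x₁ / x₀) ∧ d(x₂ / x₀)` has divisor `-3 D₀`, and every rational 2-form is a multiple of it,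
  so each canonical divisor is `-3 D₀` plus a principal divisor (`IsCanonicalDivisor.exists_eq`). In
  each chart the local rings are localizations of `ℂ[u, v]`, so `du, dv` is a basis of their
  differentials.
* Since `Dᵢ - D₀` is the divisor of `xᵢ / x₀`, the divisor `-(K + ∑ i ∈ S, Dᵢ)` is linearly equivalent to
  `(3 - |S|) D₀`. A positive multiple of a line is ample, because the complements of the coordinate
  lines are affine (`isAmpleDivisor_of_pos`). A principal divisor is not: its multiples have only
  nowhere vanishing sections, while `ℙ²` is not affine (`not_isAmpleDivisor_of_principal`). Thus
  `-(K + D)` is ample exactly when `S` is not everything.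
-/

noncomputable section

/-! ### Local rings and the function field inside `ℂ(x₀, x₁, x₂)` -/

/-- The homogeneous coordinate ring `ℂ[x₀, x₁, x₂]`. -/
abbrev CoordRing : Type := MvPolynomial (Fin 3) ℂ

/-- The field `ℂ(x₀, x₁, x₂)`; the function field of `ℙ²` and all the local rings are embedded
in it as fractions of homogeneous polynomials of equal degree. -/
abbrev RatFun : Type := FractionRing CoordRing

instance isPrime_asHomogeneousIdeal (y : ProjectiveSpectrum polyGrading) :
    y.asHomogeneousIdeal.toIdeal.IsPrime := y.isPrime

instance P2.isPrime_asHomogeneousIdeal (y : P2) : y.asHomogeneousIdeal.toIdeal.IsPrime := y.isPrime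

/-- The homogeneous prime ideal of a point of `ℙ²`, as an ideal of the coordinate ring. -/
def idealOf (y : P2) : Ideal CoordRing := y.asHomogeneousIdeal.toIdeal

instance isPrime_idealOf (y : P2) : (idealOf y).IsPrime := y.isPrime

/-- The embedding into the field of fractions of the localization at a prime ideal. -/
def locToFrac (I : Ideal CoordRing) [I.IsPrime] : Localization.AtPrime I →+* RatFun :=
  IsLocalization.lift (M := I.primeCompl) (g := algebraMap CoordRing RatFun) fun b =>
    IsUnit.mk0 _ ((FaithfulSMul.algebraMap_eq_zero_iff _ _).not.mpr
      fun h => b.2 (h ▸ I.zero_mem))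

lemma locToFrac_mk (I : Ideal CoordRing) [I.IsPrime] (a : CoordRing) (b : I.primeCompl) :
    locToFrac I (Localization.mk a b) =
      algebraMap CoordRing RatFun a / algebraMap CoordRing RatFun b := by
  have hb : algebraMap CoordRing RatFun b ≠ 0 :=
    (FaithfulSMul.algebraMap_eq_zero_iff _ _).not.mpr fun h => b.2 (h ▸ I.zero_mem)
  rw [locToFrac, Localization.mk_eq_mk', IsLocalization.lift_mk'_spec, mul_div_cancel₀ _ hb]

lemma locToFrac_injective (I : Ideal CoordRing) [I.IsPrime] :
    Function.Injective (locToFrac I) := by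
  rw [injective_iff_map_eq_zero]
  intro z hz
  obtain ⟨a, b, rfl⟩ := IsLocalization.exists_mk'_eq I.primeCompl z
  rw [← Localization.mk_eq_mk', locToFrac_mk, div_eq_zero_iff] at hz
  rcases hz with hz | hz
  · rw [FaithfulSMul.algebraMap_eq_zero_iff] at hz
    rw [hz, IsLocalization.mk'_zero]
  · rw [FaithfulSMul.algebraMap_eq_zero_iff] at hz
    exact absurd (hz ▸ Ideal.zero_mem _) b.2

/-- The values of a section at a point and at a generization agree as rational functions: near the
special point the section is a single fraction. -/
lemma locToFrac_section_eq {U : TopologicalSpace.Opens (ProjectiveSpectrum.top polyGrading)}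
    (s : (ProjectiveSpectrum.Proj.structureSheaf polyGrading).1.obj (.op U))
    {x y : ProjectiveSpectrum polyGrading} (h : x ⤳ y) (hx : x ∈ U) (hy : y ∈ U) :
    locToFrac x.asHomogeneousIdeal.toIdeal (s.1 ⟨x, hx⟩).val =
      locToFrac y.asHomogeneousIdeal.toIdeal (s.1 ⟨y, hy⟩).val := by
  obtain ⟨V, hyV, i, n, a, b, h', e⟩ := s.2 ⟨y, hy⟩
  have hxV : x ∈ V := h.mem_open V.2 hyV
  have e1 : s.1 ⟨y, hy⟩ = _ := e ⟨y, hyV⟩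
  have e2 : s.1 ⟨x, hx⟩ = _ := e ⟨x, hxV⟩
  rw [e1, e2]
  exact (locToFrac_mk x.asHomogeneousIdeal.toIdeal a.1 ⟨b.1, _⟩).trans
    (locToFrac_mk y.asHomogeneousIdeal.toIdeal a.1 ⟨b.1, _⟩).symm

/-- The embedding of the local ring of `ℙ²` at `y` into `ℂ(x₀, x₁, x₂)`. -/
def P2.toRatFun (y : P2) : P2.presheaf.stalk y →+* RatFun :=
  ((locToFrac y.asHomogeneousIdeal.toIdeal).comp (algebraMap
    (HomogeneousLocalization.AtPrime polyGrading y.asHomogeneousIdeal.toIdeal)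
    (Localization.AtPrime y.asHomogeneousIdeal.toIdeal))).comp
    (Proj.stalkIso' polyGrading y).toRingHom

lemma P2.toRatFun_injective (y : P2) : Function.Injective (P2.toRatFun y) :=
  (locToFrac_injective _).comp ((HomogeneousLocalization.val_injective _).comp
    (Proj.stalkIso' polyGrading y).injective)

lemma P2.exists_toRatFun_eq (y : P2) (s : P2.presheaf.stalk y) :
    ∃ (n : ℕ) (a b : CoordRing), a.IsHomogeneous n ∧ b.IsHomogeneous n ∧
      b ∉ idealOf y ∧
      P2.toRatFun y s = algebraMap CoordRing RatFun a / algebraMap CoordRing RatFun b := by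
  obtain ⟨c, hc⟩ := HomogeneousLocalization.mk_surjective (Proj.stalkIso' polyGrading y s)
  refine ⟨c.deg, c.num, c.den, c.num.2, c.den.2, c.den_mem, ?_⟩
  change locToFrac y.asHomogeneousIdeal.toIdeal (Proj.stalkIso' polyGrading y s).val = _
  rw [← hc, HomogeneousLocalization.val_mk, locToFrac_mk]

lemma P2.exists_of_isHomogeneous (y : P2) {n : ℕ} {a b : CoordRing} (ha : a.IsHomogeneous n)
    (hb : b.IsHomogeneous n) (hby : b ∉ idealOf y) :
    ∃ s : P2.presheaf.stalk y,
      P2.toRatFun y s = algebraMap CoordRing RatFun a / algebraMap CoordRing RatFun b := by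
  refine ⟨(Proj.stalkIso' polyGrading y).symm (.mk ⟨n, ⟨a, ha⟩, ⟨b, hb⟩, hby⟩), ?_⟩
  change locToFrac y.asHomogeneousIdeal.toIdeal (Proj.stalkIso' polyGrading y _).val = _
  rw [RingEquiv.apply_symm_apply, HomogeneousLocalization.val_mk, locToFrac_mk]

lemma P2.toRatFun_germ (U : P2.Opens) (y : P2) (hy : y ∈ U) (s : Γ(P2, U)) :
    P2.toRatFun y (P2.presheaf.germ U y hy s) =
      locToFrac y.asHomogeneousIdeal.toIdeal
        (((show (ProjectiveSpectrum.Proj.structureSheaf polyGrading).1.obj (.op U) from s)).1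
          ⟨y, hy⟩).val := by
  exact congrArg (fun z : HomogeneousLocalization.AtPrime polyGrading
    y.asHomogeneousIdeal.toIdeal => locToFrac y.asHomogeneousIdeal.toIdeal z.val)
      (Proj.stalkIso'_germ polyGrading U y hy s)

lemma P2.toRatFun_stalkSpecializes {x y : P2} (h : x ⤳ y) (s : P2.presheaf.stalk y) :
    P2.toRatFun x (P2.presheaf.stalkSpecializes h s) = P2.toRatFun y s := by
  obtain ⟨U, hyU, s, rfl⟩ := P2.presheaf.exists_germ_eq s
  have hxU : x ∈ U := h.mem_open U.2 hyU
  have : P2.presheaf.stalkSpecializes h (P2.presheaf.germ U y hyU s) =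
      P2.presheaf.germ U x hxU s := by
    rw [← CategoryTheory.comp_apply, P2.presheaf.germ_stalkSpecializes]
  rw [this]
  exact (P2.toRatFun_germ U x hxU s).trans ((locToFrac_section_eq _ h hxU hyU).trans
    (P2.toRatFun_germ U y hyU s).symm)

lemma P2.toRatFun_algebraMap_functionField (y : P2) (s : P2.presheaf.stalk y) :
    P2.toRatFun (genericPoint P2) (algebraMap _ P2.functionField s) = P2.toRatFun y s :=
  P2.toRatFun_stalkSpecializes _ s

lemma P2.genericPoint_eq : genericPoint P2 = P2.zeroPoint := by
  apply (genericPoint_spec P2).eq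
  refine Set.eq_univ_of_forall fun x => ?_
  rw [← specializes_iff_mem_closure, P2.specializes_iff]
  exact bot_le

/-- The identification of `Γ(X, U)` with `Γ(X, ⊤)` for `U = ⊤`, used to unfold `Proj.toSpecZero`. -/
lemma topIso_inv_comp_appTop {X : Scheme.{0}} {U : X.Opens} (e : U = ⊤) :
    U.topIso.inv ≫ (X.isoOfEq e).inv.appTop ≫ X.topIso.inv.appTop =
      X.presheaf.map (eqToHom e.symm).op := by
  subst e
  rw [Scheme.isoOfEq_rfl]
  have h := congrArg Scheme.Hom.appTop (Scheme.toIso_inv_ι X)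
  rw [Scheme.Hom.comp_appTop, Scheme.Hom.id_appTop] at h
  simp [← h]
  rfl

/-- The `ℂ`-algebra structure of a local ring, which comes from the structure morphism of `ℙ²`, is
the inclusion of the constants. -/
lemma P2.toRatFun_algebraMap (y : P2) (c : ℂ) :
    P2.toRatFun y (algebraMap ℂ (P2.presheaf.stalk y) c) = algebraMap CoordRing RatFun (C c) := by
  change P2.toRatFun y (P2.presheaf.germ ⊤ y trivial (((P2 ↘ Spec (.of ℂ)).appTop)
    ((Scheme.ΓSpecIso (.of ℂ)).inv c))) = _
  have h1 : (P2 ↘ Spec (.of ℂ)).appTop ((Scheme.ΓSpecIso (.of ℂ)).inv c) =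
    (Proj.toSpecZero polyGrading).appTop ((Scheme.ΓSpecIso _).inv (algebraMap ℂ (polyGrading 0) c)) := by
    change (Proj.toSpecZero polyGrading ≫
      Spec.map (CommRingCat.ofHom (algebraMap ℂ (polyGrading 0)))).appTop _ = _
    have := Scheme.ΓSpecIso_inv_naturality (CommRingCat.ofHom (algebraMap ℂ (polyGrading 0)))
    rw [Scheme.Hom.comp_appTop, CategoryTheory.comp_apply,
      ← CategoryTheory.comp_apply (Scheme.ΓSpecIso _).inv, ← this]
    rfl
  rw [h1]
  have h2 : (Proj.toSpecZero polyGrading).appTop = (Scheme.ΓSpecIso _).hom ≫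
     CommRingCat.ofHom (HomogeneousLocalization.fromZeroRingHom polyGrading _) ≫
        Proj.awayToSection polyGrading 1 ≫
        P2.presheaf.map (eqToHom (Proj.basicOpen_one polyGrading).symm).op := by
    have this : Scheme.Hom.appTop _ = _ := Proj.basicOpenToSpec_app_top polyGrading 1
    rw [Proj.toSpecZero]
    simp only [Scheme.Hom.comp_appTop]
    rw [this]
    have h3 := Scheme.ΓSpecIso_naturality (CommRingCat.ofHom
      (HomogeneousLocalization.fromZeroRingHom polyGrading (Submonoid.powers (1 : CoordRing))))
    simp only [Category.assoc]
    rw [reassoc_of% h3]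
    rw [topIso_inv_comp_appTop]
  rw [h2]
  simp only [CommRingCat.comp_apply, Iso.inv_hom_id_apply]
  refine (P2.toRatFun_germ ⊤ y trivial _).trans ?_
  have h4 := ProjectiveSpectrum.Proj.awayToSection_apply polyGrading 1
    (HomogeneousLocalization.fromZeroRingHom polyGrading (Submonoid.powers (1 : CoordRing))
      (algebraMap ℂ (polyGrading 0) c)) ⟨y,
      (Proj.mem_basicOpen polyGrading 1 y).mpr ((Ideal.ne_top_iff_one _).mp y.isPrime.ne_top)⟩
  refine (congrArg _ h4).trans ?_
  have h5 : (HomogeneousLocalization.fromZeroRingHom polyGrading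
      (Submonoid.powers (1 : CoordRing)) (algebraMap ℂ (polyGrading 0) c)).val =
      Localization.mk (C c) 1 := rfl
  rw [h5, Localization.mk_one_eq_algebraMap, IsLocalization.map_eq]
  rw [← Localization.mk_one_eq_algebraMap]
  refine (locToFrac_mk _ _ _).trans ?_
  simp

/-! ### Homogeneous primes and prime divisors -/

/-- The substitution `xᵢ ↦ xᵢ T`. Its value at `a` is `∑ aₙ Tⁿ`, with `aₙ` the homogeneous components
of `a`. -/
def scaleHom : CoordRing →ₐ[ℂ] Polynomial CoordRing :=
  aeval fun i => Polynomial.C (X i) * Polynomial.X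

lemma scaleHom_of_isHomogeneous {n : ℕ} {a : CoordRing} (ha : a.IsHomogeneous n) :
    scaleHom a = Polynomial.monomial n a := by
  conv_lhs => rw [a.as_sum, map_sum]
  conv_rhs => rw [a.as_sum, map_sum]
  refine Finset.sum_congr rfl fun m hm => ?_
  have hd : m.degree = n := by
    rw [Finsupp.degree_eq_weight_one]
    exact ha (mem_support_iff.mp hm)
  rw [scaleHom, aeval_monomial, ← hd, MvPolynomial.monomial_eq, ← Polynomial.C_mul_X_pow_eq_monomial]
  simp only [mul_pow, Finsupp.prod, Finset.prod_mul_distrib, Finset.prod_pow_eq_pow_sum,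
    Finsupp.degree, map_mul, map_prod, map_pow]
  rw [← mul_assoc]
  rfl

lemma eval_one_scaleHom (a : CoordRing) : (scaleHom a).eval 1 = a := by
  conv_lhs => rw [← sum_homogeneousComponent a, map_sum, Polynomial.eval_finsetSum]
  simp_rw [scaleHom_of_isHomogeneous (homogeneousComponent_isHomogeneous _ a),
    Polynomial.eval_monomial, one_pow, mul_one]
  exact sum_homogeneousComponent a

lemma coeff_scaleHom (a : CoordRing) (n : ℕ) : (scaleHom a).coeff n = homogeneousComponent n a := by
  conv_lhs => rw [← sum_homogeneousComponent a, map_sum, Polynomial.finsetSum_coeff]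
  simp_rw [scaleHom_of_isHomogeneous (homogeneousComponent_isHomogeneous _ a),
    Polynomial.coeff_monomial]
  rw [Finset.sum_ite_eq']
  split_ifs with h
  · rfl
  · rw [homogeneousComponent_eq_zero]
    simpa using h

lemma scaleHom_ne_zero {a : CoordRing} (ha : a ≠ 0) : scaleHom a ≠ 0 := fun h => ha <| by
  rw [← eval_one_scaleHom a, h, Polynomial.eval_zero]

/-- A factor of a nonzero homogeneous polynomial is homogeneous: after `xᵢ ↦ xᵢ T` the product is a
monomial in `T`, and degree and trailing degree in `T` are additive. -/
lemma MvPolynomial.IsHomogeneous.exists_of_dvd {n : ℕ} {a b : CoordRing} (hb : b.IsHomogeneous n)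
    (hb0 : b ≠ 0) (hab : a ∣ b) : ∃ k ≤ n, a.IsHomogeneous k := by
  obtain ⟨c, rfl⟩ := hab
  have ha0 : scaleHom a ≠ 0 := scaleHom_ne_zero (left_ne_zero_of_mul hb0)
  have hc0 : scaleHom c ≠ 0 := scaleHom_ne_zero (right_ne_zero_of_mul hb0)
  have h := scaleHom_of_isHomogeneous hb
  rw [map_mul] at h
  have h1 := Polynomial.natDegree_mul ha0 hc0
  have h2 := Polynomial.natTrailingDegree_mul ha0 hc0
  rw [h, Polynomial.natDegree_monomial_eq _ hb0] at h1
  rw [h, Polynomial.natTrailingDegree_monomial hb0] at h2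
  have h3 := Polynomial.natTrailingDegree_le_natDegree (scaleHom a)
  have h4 := Polynomial.natTrailingDegree_le_natDegree (scaleHom c)
  refine ⟨(scaleHom a).natDegree, by omega, ?_⟩
  have h5 : scaleHom a = Polynomial.monomial (scaleHom a).natDegree
      ((scaleHom a).coeff (scaleHom a).natDegree) := by
    ext1 i
    rw [Polynomial.coeff_monomial]
    split_ifs with hi
    · rw [hi]
    · rcases lt_or_gt_of_ne hi with hi | hi
      · exact Polynomial.coeff_eq_zero_of_natDegree_lt hi
      · exact Polynomial.coeff_eq_zero_of_lt_natTrailingDegree (by omega)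
  have h6 := congrArg (Polynomial.eval 1) h5
  rw [eval_one_scaleHom, Polynomial.eval_monomial, one_pow, mul_one, coeff_scaleHom] at h6
  have h7 := homogeneousComponent_isHomogeneous (scaleHom a).natDegree a
  rwa [← h6] at h7

lemma P2.ext_ideal {x y : P2} (h : idealOf x = idealOf y) : x = y := by
  apply ProjectiveSpectrum.ext
  exact HomogeneousIdeal.toIdeal_injective h

lemma P2.specializes_iff_ideal (x y : P2) : x ⤳ y ↔ idealOf x ≤ idealOf y := P2.specializes_iff x y

lemma homogeneousComponent_mem_idealOf (y : P2) {a : CoordRing} (ha : a ∈ idealOf y) (n : ℕ) :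
    homogeneousComponent n a ∈ idealOf y := by
  have : _ ∈ y.asHomogeneousIdeal.toIdeal := y.asHomogeneousIdeal.isHomogeneous n ha
  exact (MvPolynomial.decomposition.decompose'_apply a n) ▸ this

/-- The coordinate charts cover `ℙ²`. -/
lemma P2.exists_X_notMem (y : P2) : ∃ k : Fin 3, (X k : CoordRing) ∉ idealOf y := by
  by_contra h
  push Not at h
  apply y.not_irrelevant_le
  rw [HomogeneousIdeal.irrelevant_le]
  intro n hn p hp
  have hp : p.IsHomogeneous n := hp
  have : p ∈ Ideal.span (Set.range (X : Fin 3 → CoordRing)) := by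
    rw [← Set.image_univ, MvPolynomial.mem_ideal_span_X_image]
    intro m hm
    have := hp (mem_support_iff.mp hm)
    by_contra! h
    have : m = 0 := by ext i; simpa using h i trivial
    subst this
    simp at this
    omega
  exact (Ideal.span_le.mpr (by rintro _ ⟨k, rfl⟩; exact h k)) this

/-- The generic point of the curve `p = 0`, for a homogeneous prime element `p`. -/
def P2.ofPrime {n : ℕ} {p : CoordRing} (hp : Prime p) (hpn : p.IsHomogeneous n) : P2 where
  asHomogeneousIdeal := ⟨Ideal.span {p}, Ideal.homogeneous_span _ _ fun x hx => by
    rw [Set.mem_singleton_iff] at hx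
    exact ⟨n, hx ▸ hpn⟩⟩
  isPrime := (Ideal.span_singleton_prime hp.ne_zero).mpr hp
  not_irrelevant_le h := by
    have h1 : ∀ j, p ∣ (X j : CoordRing) := fun j =>
      Ideal.mem_span_singleton.mp (h (HomogeneousIdeal.mem_irrelevant_of_mem polyGrading one_pos
        (isHomogeneous_X ℂ j)))
    have h2 := (hp.irreducible.dvd_irreducible_iff_associated
      (X_prime (R := ℂ) (i := (0 : Fin 3))).irreducible).mp (h1 0)
    have h3 := h2.symm.dvd.trans (h1 1)
    rw [X_dvd_X] at h3
    simp at h3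

lemma P2.ideal_ofPrime {n : ℕ} {p : CoordRing} (hp : Prime p) (hpn : p.IsHomogeneous n) :
    idealOf (P2.ofPrime hp hpn) = Ideal.span {p} := rfl

lemma P2.ideal_zeroPoint : idealOf P2.zeroPoint = ⊥ := rfl

lemma P2.exists_prime_mem (y : P2) {n : ℕ} {g : CoordRing} (hg : g.IsHomogeneous n) (hg0 : g ≠ 0)
    (hgy : g ∈ idealOf y) : ∃ (k : ℕ) (p : CoordRing), Prime p ∧ p.IsHomogeneous k ∧ p ∣ g ∧
      p ∈ idealOf y := by
  have h := UniqueFactorizationMonoid.factors_prod hg0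
  have h1 : (UniqueFactorizationMonoid.factors g).prod ∈ idealOf y :=
    (idealOf y).mem_of_dvd h.symm.dvd hgy
  rw [(isPrime_idealOf y).multiset_prod_mem_iff_exists_mem] at h1
  obtain ⟨p, hp, hpy⟩ := h1
  have hpg := UniqueFactorizationMonoid.dvd_of_mem_factors hp
  obtain ⟨k, -, hk⟩ := hg.exists_of_dvd hg0 hpg
  exact ⟨k, p, UniqueFactorizationMonoid.prime_of_factor p hp, hk, hpg, hpy⟩

lemma P2.exists_isHomogeneous_mem {I : Ideal CoordRing} {y : P2} (h : ¬ idealOf y ≤ I) :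
    ∃ (n : ℕ) (g : CoordRing), g.IsHomogeneous n ∧ g ∈ idealOf y ∧ g ∉ I := by
  obtain ⟨a, ha, ha0⟩ := Set.not_subset.mp h
  by_contra! h'
  apply ha0
  rw [← sum_homogeneousComponent a]
  exact Ideal.sum_mem _ fun i _ => h' i _ (homogeneousComponent_isHomogeneous _ _)
    (homogeneousComponent_mem_idealOf y ha i)

lemma P2.lt_iff {x y : P2} : x < y ↔ idealOf y < idealOf x := by
  rw [lt_iff_le_not_ge, lt_iff_le_not_ge]
  exact and_congr (P2.specializes_iff y x) (P2.specializes_iff x y).not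

lemma P2.coheight_zeroPoint : Order.coheight P2.zeroPoint = 0 := by
  rw [Order.coheight_eq_zero]
  intro z hz
  change P2.zeroPoint ⤳ z
  rw [P2.specializes_iff]
  exact bot_le

lemma P2.eq_zeroPoint_of_lt {p : CoordRing} (hp : Prime p) 
    {y : P2} (hy : idealOf y < Ideal.span {p}) : y = P2.zeroPoint := by
  apply P2.ext_ideal
  rw [P2.ideal_zeroPoint]
  by_contra hne
  obtain ⟨n, g, hg, hgy, hg0⟩ := P2.exists_isHomogeneous_mem (fun h => hne (le_bot_iff.mp h))
  obtain ⟨k, q, hq, -, -, hqy⟩ := P2.exists_prime_mem y hg (fun h => hg0 (h ▸ zero_mem _)) hgy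
  have h1 := Ideal.mem_span_singleton.mp (hy.le hqy)
  have h2 := (hp.irreducible.dvd_irreducible_iff_associated hq.irreducible).mp h1
  exact hy.not_ge ((Ideal.span_singleton_le_iff_mem _).mpr ((idealOf y).mem_of_dvd h2.symm.dvd hqy))

lemma P2.coheight_eq_one_of_ideal_eq {p : CoordRing} (hp : Prime p) {y : P2}
    (hy : idealOf y = Ideal.span {p}) : Order.coheight y = 1 := by
  apply le_antisymm
  · refine Order.coheight_le_coe_iff (n := 1) |>.mpr fun z hz => ?_
    have hz' := P2.lt_iff.mp (gt_iff_lt.mp hz)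
    rw [hy] at hz'
    rw [P2.eq_zeroPoint_of_lt hp hz', P2.coheight_zeroPoint]
    exact_mod_cast zero_lt_one
  · rw [Order.one_le_iff_ne_zero, Order.coheight_ne_zero]
    intro h
    have : y < P2.zeroPoint := by
      rw [P2.lt_iff, hy, P2.ideal_zeroPoint, bot_lt_iff_ne_bot, Ne, Ideal.span_singleton_eq_bot]
      exact hp.ne_zero
    exact absurd (h this.le) this.not_ge

/-- Every prime divisor of `ℙ²` is a curve `p = 0`. -/
lemma PrimeDivisor.exists_prime (P : PrimeDivisor P2) : ∃ (n : ℕ) (p : CoordRing), Prime p ∧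
    p.IsHomogeneous n ∧ idealOf P.1 = Ideal.span {p} := by
  have h0 : idealOf P.1 ≠ ⊥ := fun h => by
    have h1 : P.1 = P2.zeroPoint := P2.ext_ideal h
    have h2 := P.2
    rw [h1, P2.coheight_zeroPoint] at h2
    exact zero_ne_one h2
  obtain ⟨n, g, hg, hgy, hg0⟩ := P2.exists_isHomogeneous_mem (fun h => h0 (le_bot_iff.mp h))
  obtain ⟨k, q, hq, hqk, -, hqy⟩ := P2.exists_prime_mem P.1 hg (fun h => hg0 (h ▸ zero_mem _)) hgy
  refine ⟨k, q, hq, hqk, ?_⟩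
  by_contra hne
  have hlt : P.1 < P2.ofPrime hq hqk := by
    rw [P2.lt_iff, P2.ideal_ofPrime]
    exact lt_of_le_of_ne ((Ideal.span_singleton_le_iff_mem _).mpr hqy) (Ne.symm hne)
  have h1 := Order.coheight_add_one_le hlt
  rw [P2.coheight_eq_one_of_ideal_eq hq (P2.ideal_ofPrime hq hqk), P.2] at h1
  exact absurd h1 (by decide)

/-! ### Orders of vanishing -/

lemma algebraMap_ratFun_ne_zero {a : CoordRing} (ha : a ≠ 0) : algebraMap CoordRing RatFun a ≠ 0 :=
  (FaithfulSMul.algebraMap_eq_zero_iff _ _).not.mpr ha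

lemma ne_zero_of_notMem_idealOf {y : P2} {b : CoordRing} (hb : b ∉ idealOf y) : b ≠ 0 :=
  fun h => hb (h ▸ (idealOf y).zero_mem)

lemma P2.isUnit_of_toRatFun_eq {y : P2} {s : P2.presheaf.stalk y} {n : ℕ} {a b : CoordRing}
    (ha : a.IsHomogeneous n) (hb : b.IsHomogeneous n) (hay : a ∉ idealOf y) (hby : b ∉ idealOf y)
    (hs : P2.toRatFun y s = algebraMap CoordRing RatFun a / algebraMap CoordRing RatFun b) :
    IsUnit s := by
  obtain ⟨t, ht⟩ := P2.exists_of_isHomogeneous y hb ha hay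
  refine IsUnit.of_mul_eq_one t (P2.toRatFun_injective y ?_)
  have h1 := algebraMap_ratFun_ne_zero (ne_zero_of_notMem_idealOf hay)
  have h2 := algebraMap_ratFun_ne_zero (ne_zero_of_notMem_idealOf hby)
  rw [map_mul, hs, ht, map_one]
  field_simp

lemma P2.mem_idealOf_of_not_isUnit {y : P2} {s : P2.presheaf.stalk y} {n : ℕ} {a b : CoordRing}
    (ha : a.IsHomogeneous n) (hb : b.IsHomogeneous n) (hby : b ∉ idealOf y)
    (hs : P2.toRatFun y s = algebraMap CoordRing RatFun a / algebraMap CoordRing RatFun b)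
    (hu : ¬ IsUnit s) : a ∈ idealOf y := by
  by_contra hay
  exact hu (P2.isUnit_of_toRatFun_eq ha hb hay hby hs)

lemma P2.not_isUnit_of_mem {y : P2} {s : P2.presheaf.stalk y} {a b : CoordRing}
    (hay : a ∈ idealOf y) (hby : b ∉ idealOf y)
    (hs : P2.toRatFun y s = algebraMap CoordRing RatFun a / algebraMap CoordRing RatFun b) :
    ¬ IsUnit s := by
  intro hu
  obtain ⟨t, ht⟩ := hu.exists_right_inv
  obtain ⟨n, c, d, -, -, hd, hcd⟩ := P2.exists_toRatFun_eq y t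
  have h1 := algebraMap_ratFun_ne_zero (ne_zero_of_notMem_idealOf hby)
  have h2 := algebraMap_ratFun_ne_zero (ne_zero_of_notMem_idealOf hd)
  have h := congrArg (P2.toRatFun y) ht
  rw [map_mul, hs, hcd, map_one] at h
  field_simp at h
  rw [← map_mul, ← map_mul] at h
  have h3 := FaithfulSMul.algebraMap_injective CoordRing RatFun h
  have h4 : b * d ∈ idealOf y := h3 ▸ (idealOf y).mul_mem_right _ hay
  exact ((isPrime_idealOf y).mem_or_mem h4).elim hby hd

section General

universe u

variable {X : Scheme.{u}} [IsIntegral X] [IsLocallyNoetherian X]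

lemma AlgebraicGeometry.Scheme.ord_algebraMap_of_isUnit (x : X) (s : X.presheaf.stalk x)
    (hs : IsUnit s) : X.ord (algebraMap _ X.functionField s) x = 0 := by
  by_cases hx : Order.coheight x = 1
  · have hs0 : algebraMap _ X.functionField s ≠ 0 := (hs.map _).ne_zero
    have : Ring.KrullDimLE 1 (X.presheaf.stalk x) := krullDimLE_of_coheight_le hx.le
    rw [Scheme.ord_eq_iff hx hs0]
    exact Ring.ordFrac_of_isUnit hs
  · exact Scheme.ord_eq_zero_of_coheight_neq_one hx _

lemma AlgebraicGeometry.Scheme.ord_algebraMap_of_maximalIdeal_eq_span {x : X}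
    (hx : Order.coheight x = 1) (s : X.presheaf.stalk x)
    (hs : IsLocalRing.maximalIdeal (X.presheaf.stalk x) = Ideal.span {s}) (hs0 : s ≠ 0) :
    X.ord (algebraMap _ X.functionField s) x = 1 := by
  have : Ring.KrullDimLE 1 (X.presheaf.stalk x) := krullDimLE_of_coheight_le hx.le
  have hs' : algebraMap _ X.functionField s ≠ 0 :=
    (FaithfulSMul.algebraMap_eq_zero_iff _ _).not.mpr hs0
  rw [Scheme.ord_eq_iff hx hs']
  change Ring.ordFrac (X.presheaf.stalk x) _ = _
  rw [Ring.ordFrac_eq_ord _ hs0]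
  refine Ring.ordMonoidWithZeroHom_eq_coe (n := 1) _ (mem_nonZeroDivisors_of_ne_zero hs0) ?_
  rw [Ring.ord, Nat.cast_one, Module.length_eq_one_iff, ← hs, isSimpleModule_iff_isCoatom]
  exact Ideal.isMaximal_def.mp (IsLocalRing.maximalIdeal.isMaximal _)

lemma AlgebraicGeometry.Scheme.ord_one (x : X) : X.ord (1 : X.functionField) x = 0 := by
  have := X.ord_algebraMap_of_isUnit x 1 isUnit_one
  rwa [map_one] at this

lemma AlgebraicGeometry.Scheme.ord_inv {f : X.functionField} (hf : f ≠ 0) (x : X) :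
    X.ord f⁻¹ x = - X.ord f x := by
  have := X.ord_mul (x := x) hf (inv_ne_zero hf)
  rw [mul_inv_cancel₀ hf, X.ord_one] at this
  omega

lemma AlgebraicGeometry.Scheme.ord_pow {f : X.functionField} (hf : f ≠ 0) (n : ℕ) (x : X) :
    X.ord (f ^ n) x = n * X.ord f x := by
  induction n with
  | zero => simp [X.ord_one]
  | succ n ih =>
    rw [pow_succ, X.ord_mul (pow_ne_zero _ hf) hf, ih]
    push_cast
    ring

lemma AlgebraicGeometry.Scheme.ord_prod {ι : Type*} (S : Finset ι) (f : ι → X.functionField)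
    (hf : ∀ i ∈ S, f i ≠ 0) (x : X) : X.ord (∏ i ∈ S, f i) x = ∑ i ∈ S, X.ord (f i) x := by
  classical
  induction S using Finset.induction_on with
  | empty => simp [X.ord_one]
  | insert i S hi ih =>
    rw [Finset.prod_insert hi, Finset.sum_insert hi,
      X.ord_mul (hf i (by simp)) (Finset.prod_ne_zero_iff.mpr fun j hj => hf j (by simp [hj])),
      ih fun j hj => hf j (by simp [hj])]

end General

/-- The embedding of the function field of `ℙ²` into `ℂ(x₀, x₁, x₂)`. -/
abbrev functionFieldToRatFun : P2.functionField →+* RatFun := P2.toRatFun (genericPoint P2)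

lemma exists_functionField {n : ℕ} {a b : CoordRing} (ha : a.IsHomogeneous n)
    (hb : b.IsHomogeneous n) (hb0 : b ≠ 0) : ∃ f : P2.functionField,
    functionFieldToRatFun f = algebraMap CoordRing RatFun a / algebraMap CoordRing RatFun b := by
  refine P2.exists_of_isHomogeneous _ ha hb ?_
  rw [P2.genericPoint_eq]
  exact hb0

lemma exists_eq_div_of_functionField (f : P2.functionField) :
    ∃ (n : ℕ) (a b : CoordRing), a.IsHomogeneous n ∧ b.IsHomogeneous n ∧ b ≠ 0 ∧
    functionFieldToRatFun f = algebraMap CoordRing RatFun a / algebraMap CoordRing RatFun b := by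
  obtain ⟨n, a, b, ha, hb, hb0, h⟩ := P2.exists_toRatFun_eq (genericPoint P2) f
  exact ⟨n, a, b, ha, hb, ne_zero_of_notMem_idealOf hb0, h⟩

lemma exists_stalk_eq {y : P2} {f : P2.functionField} {n : ℕ} {a b : CoordRing}
    (ha : a.IsHomogeneous n) (hb : b.IsHomogeneous n) (hby : b ∉ idealOf y)
    (hf : functionFieldToRatFun f =
      algebraMap CoordRing RatFun a / algebraMap CoordRing RatFun b) :
    ∃ s : P2.presheaf.stalk y, algebraMap _ P2.functionField s = f ∧
      P2.toRatFun y s = algebraMap CoordRing RatFun a / algebraMap CoordRing RatFun b := by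
  obtain ⟨s, hs⟩ := P2.exists_of_isHomogeneous y ha hb hby
  refine ⟨s, P2.toRatFun_injective _ ?_, hs⟩
  rw [P2.toRatFun_algebraMap_functionField, hs]
  exact hf.symm

lemma ord_eq_zero_of_notMem {y : P2} {f : P2.functionField} {n : ℕ} {a b : CoordRing}
    (ha : a.IsHomogeneous n) (hb : b.IsHomogeneous n) (hay : a ∉ idealOf y) (hby : b ∉ idealOf y)
    (hf : functionFieldToRatFun f =
      algebraMap CoordRing RatFun a / algebraMap CoordRing RatFun b) :
    P2.ord f y = 0 := by
  obtain ⟨s, rfl, hs⟩ := exists_stalk_eq ha hb hby hf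
  exact P2.ord_algebraMap_of_isUnit y s (P2.isUnit_of_toRatFun_eq ha hb hay hby hs)

/-- At the generic point of the curve `p = 0` the fraction `p / q` is a uniformizer, if `q` does not
vanish on the curve. -/
lemma maximalIdeal_stalk_eq_span {y : P2} {p : CoordRing} {d : ℕ} (hp : Prime p)
    (hpd : p.IsHomogeneous d) (hy : idealOf y = Ideal.span {p}) {q : CoordRing}
    (hq : q.IsHomogeneous d) (hqy : q ∉ idealOf y) {s : P2.presheaf.stalk y}
    (hs : P2.toRatFun y s = algebraMap CoordRing RatFun p / algebraMap CoordRing RatFun q) :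
    IsLocalRing.maximalIdeal (P2.presheaf.stalk y) = Ideal.span {s} := by
  have hpy : p ∈ idealOf y := hy ▸ Ideal.mem_span_singleton_self p
  have h1 := algebraMap_ratFun_ne_zero (ne_zero_of_notMem_idealOf hqy)
  have h2 := algebraMap_ratFun_ne_zero hp.ne_zero
  apply le_antisymm
  · intro t ht
    obtain ⟨n, a, b, ha, hb, hby, hab⟩ := P2.exists_toRatFun_eq y t
    have hay := P2.mem_idealOf_of_not_isUnit ha hb hby hab ht
    rw [hy, Ideal.mem_span_singleton] at hay
    rw [Ideal.mem_span_singleton]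
    by_cases ha0 : a = 0
    · have : t = 0 := P2.toRatFun_injective _ (by rw [hab, ha0, map_zero, zero_div, map_zero])
      rw [this]
      exact dvd_zero _
    obtain ⟨c, rfl⟩ := hay
    obtain ⟨e, -, hc⟩ := ha.exists_of_dvd ha0 (dvd_mul_left c p)
    have hde : d + e = n := (hpd.mul hc).inj_right ha ha0
    obtain ⟨r, hr⟩ := P2.exists_of_isHomogeneous y (hq.mul hc) (hde ▸ hb) hby
    refine ⟨r, P2.toRatFun_injective _ ?_⟩
    have h3 := algebraMap_ratFun_ne_zero (ne_zero_of_notMem_idealOf hby)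
    rw [map_mul, hab, hs, hr, map_mul, map_mul]
    field_simp
  · rw [Ideal.span_singleton_le_iff_mem]
    exact P2.not_isUnit_of_mem hpy hqy hs

lemma ord_uniformizer (P : PrimeDivisor P2) {p : CoordRing} {d : ℕ} (hp : Prime p)
    (hpd : p.IsHomogeneous d) (hP : idealOf P.1 = Ideal.span {p}) {q : CoordRing}
    (hq : q.IsHomogeneous d) (hqP : q ∉ idealOf P.1) {π : P2.functionField}
    (hπ : functionFieldToRatFun π = algebraMap CoordRing RatFun p /
      algebraMap CoordRing RatFun q) : P2.ord π P.1 = 1 := by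
  obtain ⟨s, rfl, hs⟩ := exists_stalk_eq hpd hq hqP hπ
  refine P2.ord_algebraMap_of_maximalIdeal_eq_span P.2 s
    (maximalIdeal_stalk_eq_span hp hpd hP hq hqP hs) ?_
  rintro rfl
  rw [map_zero] at hs
  exact div_ne_zero (algebraMap_ratFun_ne_zero hp.ne_zero)
    (algebraMap_ratFun_ne_zero (ne_zero_of_notMem_idealOf hqP)) hs.symm

/-- The order of `a / b` along the curve `p = 0` is the difference of the multiplicities of `p`. -/
lemma ord_eq_multiplicity_sub (P : PrimeDivisor P2) {p : CoordRing} {d : ℕ} (hp : Prime p)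
    (hpd : p.IsHomogeneous d) (hP : idealOf P.1 = Ideal.span {p}) {f : P2.functionField}
    {n : ℕ} {a b : CoordRing} (ha : a.IsHomogeneous n) (hb : b.IsHomogeneous n) (ha0 : a ≠ 0)
    (hb0 : b ≠ 0) (hf : functionFieldToRatFun f =
      algebraMap CoordRing RatFun a / algebraMap CoordRing RatFun b) :
    P2.ord f P.1 = multiplicity p a - multiplicity p b := by
  obtain ⟨k, hk⟩ := P2.exists_X_notMem P.1
  have hkd : ∀ e : ℕ, (X k ^ e : CoordRing) ∉ idealOf P.1 :=
    fun e h => hk ((isPrime_idealOf _).mem_of_pow_mem _ h)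
  have hXd : ∀ e, (X k ^ e : CoordRing).IsHomogeneous e := isHomogeneous_X_pow k
  -- The uniformizer `p / xₖ ^ d`; then `a / b = u * π ^ (i - j)` with `u` a unit along the curve.
  obtain ⟨π, hπ⟩ := exists_functionField hpd (hXd d) (ne_zero_of_notMem_idealOf (hkd d))
  have hord := ord_uniformizer P hp hpd hP (hXd d) (hkd d) hπ
  have hX0 : (X k : CoordRing) ≠ 0 := X_ne_zero k
  have hπ0 : π ≠ 0 := by
    rintro rfl
    rw [map_zero] at hπ
    exact div_ne_zero (algebraMap_ratFun_ne_zero hp.ne_zero)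
      (algebraMap_ratFun_ne_zero (pow_ne_zero d hX0)) hπ.symm
  have fa := FiniteMultiplicity.of_prime_left hp ha0
  have fb := FiniteMultiplicity.of_prime_left hp hb0
  obtain ⟨a', ha', hpa⟩ := fa.exists_eq_pow_mul_and_not_dvd
  obtain ⟨b', hb', hpb⟩ := fb.exists_eq_pow_mul_and_not_dvd
  set i := multiplicity p a
  set j := multiplicity p b
  obtain ⟨e, -, hae⟩ := ha.exists_of_dvd ha0 (ha' ▸ dvd_mul_left a' _)
  obtain ⟨e', -, hbe⟩ := hb.exists_of_dvd hb0 (hb' ▸ dvd_mul_left b' _)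
  have ha'0 : a' ≠ 0 := fun h => hpa (h ▸ dvd_zero p)
  have hb'0 : b' ≠ 0 := fun h => hpb (h ▸ dvd_zero p)
  have hn : d * i + e = n := ((hpd.pow i).mul hae).inj_right (ha' ▸ ha) (ha' ▸ ha0)
  have hn' : d * j + e' = n := ((hpd.pow j).mul hbe).inj_right (hb' ▸ hb) (hb' ▸ hb0)
  have hna : (X k ^ (d * i) * a').IsHomogeneous n := hn ▸ (hXd (d * i)).mul hae
  have hnb : (X k ^ (d * j) * b').IsHomogeneous n := hn' ▸ (hXd (d * j)).mul hbe
  have hmem : ∀ (e : ℕ) (c : CoordRing), ¬ p ∣ c → X k ^ e * c ∉ idealOf P.1 := by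
    intro e c hc h
    rcases (isPrime_idealOf _).mem_or_mem h with h | h
    · exact hkd e h
    · rw [hP, Ideal.mem_span_singleton] at h
      exact hc h
  obtain ⟨u, hu⟩ := exists_functionField hna hnb
    (mul_ne_zero (pow_ne_zero _ hX0) hb'0)
  have hu0 : u ≠ 0 := by
    rintro rfl
    rw [map_zero] at hu
    exact div_ne_zero (algebraMap_ratFun_ne_zero (mul_ne_zero (pow_ne_zero _ hX0) ha'0))
      (algebraMap_ratFun_ne_zero (mul_ne_zero (pow_ne_zero _ hX0) hb'0)) hu.symm
  have hordu := ord_eq_zero_of_notMem hna hnb (hmem _ _ hpa) (hmem _ _ hpb) hu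
  have hf' : f * π ^ j = u * π ^ i := by
    apply P2.toRatFun_injective
    have h1 := algebraMap_ratFun_ne_zero hX0
    have h2 := algebraMap_ratFun_ne_zero hp.ne_zero
    have h3 := algebraMap_ratFun_ne_zero hb'0
    rw [map_mul, map_mul, map_pow, map_pow, hf, hu, hπ, ha', hb']
    simp only [map_mul, map_pow, pow_mul, div_pow]
    field_simp
  have hf0 : f ≠ 0 := by
    rintro rfl
    rw [zero_mul] at hf'
    exact mul_ne_zero hu0 (pow_ne_zero _ hπ0) hf'.symm
  have := congrArg (fun g => P2.ord g P.1) hf'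
  simp only [P2.ord_mul hf0 (pow_ne_zero _ hπ0), P2.ord_mul hu0 (pow_ne_zero _ hπ0),
    P2.ord_pow hπ0, hord, hordu] at this
  omega

/-! ### Ampleness -/

lemma idealOf_coordPoint (i : Fin 3) : idealOf (coordPoint i) = Ideal.span {X i} := rfl

/-- The prime divisor `xᵢ = 0`. -/
def coordDivisor (i : Fin 3) : PrimeDivisor P2 := ⟨coordPoint i, coheight_coordPoint i⟩

lemma coordLine_eq_single (i : Fin 3) : coordLine i = Finsupp.single (coordDivisor i) 1 := rfl

lemma eq_coordDivisor_iff {P : PrimeDivisor P2} {i : Fin 3} :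
    P = coordDivisor i ↔ P.1 = coordPoint i := Subtype.ext_iff

lemma coordLine_apply (i : Fin 3) (P : PrimeDivisor P2) [Decidable (P.1 = coordPoint i)] :
    coordLine i P = if P.1 = coordPoint i then 1 else 0 := by
  classical
  rw [coordLine_eq_single, Finsupp.single_apply]
  exact if_congr (eq_comm.trans eq_coordDivisor_iff) rfl rfl

lemma eq_coordPoint_of_mem {P : PrimeDivisor P2} {i : Fin 3}
    (h : (X i : CoordRing) ∈ idealOf P.1) : P.1 = coordPoint i := by
  obtain ⟨n, p, hp, hpn, hP⟩ := P.exists_prime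
  apply P2.ext_ideal
  rw [idealOf_coordPoint]
  rw [hP, Ideal.mem_span_singleton] at h
  rw [hP, Ideal.span_singleton_eq_span_singleton]
  exact (hp.irreducible.dvd_irreducible_iff_associated (X_prime (i := i)).irreducible).mp h

lemma X_mem_iff_eq_coordPoint {P : PrimeDivisor P2} {i : Fin 3} :
    (X i : CoordRing) ∈ idealOf P.1 ↔ P.1 = coordPoint i := by
  refine ⟨eq_coordPoint_of_mem, fun h => ?_⟩
  rw [h, idealOf_coordPoint]
  exact Ideal.mem_span_singleton_self _

lemma coordPoint_specializes_iff {i : Fin 3} {y : P2} :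
    coordPoint i ⤳ y ↔ (X i : CoordRing) ∈ idealOf y := by
  rw [P2.specializes_iff_ideal, idealOf_coordPoint, Ideal.span_singleton_le_iff_mem]

lemma multiplicity_X_eq_coordLine (P : PrimeDivisor P2) {p : CoordRing} (hp : Prime p)
    (hP : idealOf P.1 = Ideal.span {p}) (i : Fin 3) :
    (multiplicity p (X i : CoordRing) : ℤ) = coordLine i P := by
  classical
  have hX := X_prime (R := ℂ) (i := i)
  rw [coordLine_apply]
  have hmem : p ∣ X i ↔ P.1 = coordPoint i := by
    rw [← X_mem_iff_eq_coordPoint, hP, Ideal.mem_span_singleton]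
  split_ifs with h
  · have ha := (hp.irreducible.dvd_irreducible_iff_associated hX.irreducible).mp (hmem.mpr h)
    rw [multiplicity_eq_of_associated_left ha.symm, multiplicity_self, Nat.cast_one]
  · rw [multiplicity_eq_zero.mpr (hmem.not.mpr h)]
    rfl

/-- The rational function `xᵢ / xⱼ`. -/
def coordRatio (i j : Fin 3) : P2.functionField :=
  (exists_functionField (isHomogeneous_X ℂ i) (isHomogeneous_X ℂ j) (X_ne_zero j)).choose

lemma toRatFun_coordRatio (i j : Fin 3) : functionFieldToRatFun (coordRatio i j) =
    algebraMap CoordRing RatFun (X i) / algebraMap CoordRing RatFun (X j) :=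
  (exists_functionField (isHomogeneous_X ℂ i) (isHomogeneous_X ℂ j) (X_ne_zero j)).choose_spec

lemma coordRatio_ne_zero (i j : Fin 3) : coordRatio i j ≠ 0 := by
  intro h
  have := toRatFun_coordRatio i j
  rw [h, map_zero] at this
  exact div_ne_zero (algebraMap_ratFun_ne_zero (X_ne_zero i))
      (algebraMap_ratFun_ne_zero (X_ne_zero j)) this.symm

lemma ord_coordRatio (i j : Fin 3) (P : PrimeDivisor P2) :
    P2.ord (coordRatio i j) P.1 = coordLine i P - coordLine j P := by
  obtain ⟨n, p, hp, hpn, hP⟩ := P.exists_prime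
  rw [ord_eq_multiplicity_sub P hp hpn hP (isHomogeneous_X ℂ i) (isHomogeneous_X ℂ j)
    (X_ne_zero i) (X_ne_zero j) (toRatFun_coordRatio i j), multiplicity_X_eq_coordLine P hp hP,
    multiplicity_X_eq_coordLine P hp hP]

lemma MvPolynomial.IsHomogeneous.exists_eq_C {a : CoordRing} (ha : a.IsHomogeneous 0) :
    ∃ c : ℂ, a = C c :=
  ⟨_, totalDegree_eq_zero_iff_eq_C.mp (Nat.le_zero.mp ha.totalDegree_le)⟩

/-- A rational function without poles is constant: a prime factor of the denominator also divides the
numerator, and cancelling it lowers the degree. -/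
lemma exists_eq_C_of_ord_nonneg {f : P2.functionField}
    (hf : ∀ P : PrimeDivisor P2, 0 ≤ P2.ord f P.1) :
    ∃ c : ℂ, functionFieldToRatFun f = algebraMap CoordRing RatFun (C c) := by
  obtain ⟨n, hn⟩ : ∃ n, ∃ (a b : CoordRing), a.IsHomogeneous n ∧ b.IsHomogeneous n ∧ b ≠ 0 ∧
    functionFieldToRatFun f = algebraMap CoordRing RatFun a / algebraMap CoordRing RatFun b :=
    exists_eq_div_of_functionField f
  induction n using Nat.strong_induction_on with
  | _ n ih =>
  obtain ⟨a, b, ha, hb, hb0, hab⟩ := hn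
  by_cases ha0 : a = 0
  · exact ⟨0, by rw [hab, ha0, C_0, map_zero, zero_div]⟩
  by_cases hbu : IsUnit b
  · have hn0 : n = 0 := by
      rw [MvPolynomial.isUnit_iff_eq_C_of_isReduced] at hbu
      obtain ⟨c, hc, rfl⟩ := hbu
      exact (hb.inj_right (isHomogeneous_C _ c) hb0)
    subst hn0
    obtain ⟨c, rfl⟩ := ha.exists_eq_C
    obtain ⟨d, rfl⟩ := hb.exists_eq_C
    have hd : d ≠ 0 := by
      rintro rfl
      exact hb0 C_0
    refine ⟨c / d, ?_⟩
    rw [hab, div_eq_iff (algebraMap_ratFun_ne_zero hb0), ← map_mul, ← C_mul, div_mul_cancel₀ _ hd]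
  · obtain ⟨p, hp, hpb⟩ := WfDvdMonoid.exists_irreducible_factor hbu hb0
    have hp := hp.prime
    obtain ⟨d, hdn, hpd⟩ := hb.exists_of_dvd hb0 hpb
    have hd0 : d ≠ 0 := by
      rintro rfl
      obtain ⟨c, rfl⟩ := hpd.exists_eq_C
      have hc : c ≠ 0 := by
        rintro rfl
        exact hp.ne_zero C_0
      exact hp.not_isUnit ((IsUnit.mk0 c hc).map C)
    have hord := hf ⟨P2.ofPrime hp hpd, P2.coheight_eq_one_of_ideal_eq hp rfl⟩
    rw [ord_eq_multiplicity_sub ⟨P2.ofPrime hp hpd, P2.coheight_eq_one_of_ideal_eq hp rfl⟩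
      hp hpd rfl ha hb ha0 hb0 hab] at hord
    have h1 : multiplicity p b ≠ 0 := fun h => (multiplicity_eq_zero.mp h) hpb
    have h2 : p ∣ a := by
      by_contra h
      rw [multiplicity_eq_zero.mpr h] at hord
      omega
    obtain ⟨a', rfl⟩ := h2
    obtain ⟨b', rfl⟩ := hpb
    obtain ⟨e, -, hae⟩ := ha.exists_of_dvd ha0 (dvd_mul_left a' _)
    obtain ⟨e', -, hbe⟩ := hb.exists_of_dvd hb0 (dvd_mul_left b' _)
    have he : d + e = n := (hpd.mul hae).inj_right ha ha0
    have he' : d + e' = n := (hpd.mul hbe).inj_right hb hb0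
    obtain rfl : e = e' := by omega
    refine ih e (by omega) ⟨a', b', hae, hbe, right_ne_zero_of_mul hb0, ?_⟩
    rw [hab, map_mul, map_mul, mul_div_mul_left _ _ (algebraMap_ratFun_ne_zero hp.ne_zero)]

lemma ord_eq_zero_of_eq_C {f : P2.functionField} (hf0 : f ≠ 0) {c : ℂ}
    (hf : functionFieldToRatFun f = algebraMap CoordRing RatFun (C c)) (y : P2) :
    P2.ord f y = 0 := by
  have hc : c ≠ 0 := by
    rintro rfl
    rw [C_0, map_zero, map_eq_zero] at hf
    exact hf0 hf
  have hu : ∀ c : ℂ, c ≠ 0 → (C c : CoordRing) ∉ idealOf y := fun c hc h =>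
    (isPrime_idealOf y).ne_top (Ideal.eq_top_of_isUnit_mem _ h ((IsUnit.mk0 c hc).map C))
  refine ord_eq_zero_of_notMem (isHomogeneous_C _ c) (isHomogeneous_C _ 1) (hu c hc)
    (hu 1 one_ne_zero) ?_
  rw [hf, C_1, map_one, div_one]

/-- `ℙ²` is not affine: its global functions are constant, so none of them vanishes on `x₀ = 0` but
not at the generic point. -/
lemma P2.not_isAffineOpen_top : ¬ IsAffineOpen (⊤ : P2.Opens) := by
  intro h
  have hx : P2.zeroPoint ∈ (⊤ : P2.Opens) := trivial
  have hxV : P2.zeroPoint ∈ Proj.basicOpen polyGrading (X 0) :=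
    (Proj.mem_basicOpen _ _ _).mpr fun h => X_ne_zero (R := ℂ) (0 : Fin 3) h
  obtain ⟨f, hfV, hxf⟩ := h.exists_basicOpen_le (V := Proj.basicOpen polyGrading (X 0))
    ⟨P2.zeroPoint, hxV⟩ hx
  have hne : Nonempty (⊤ : P2.Opens) := ⟨⟨_, hx⟩⟩
  have hunit : ∀ y : P2, IsUnit (P2.presheaf.germ ⊤ y trivial f) := by
    set g := P2.germToFunctionField ⊤ f with hg
    have hgy : ∀ y : P2, algebraMap _ P2.functionField (P2.presheaf.germ ⊤ y trivial f) = g :=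
      fun y => P2.algebraMap_germ_eq_germToFunctionField (x := y) (U := ⊤) trivial f
    have hgy' : ∀ y : P2, P2.toRatFun y (P2.presheaf.germ ⊤ y trivial f) = functionFieldToRatFun g :=
      fun y => by rw [← hgy y, P2.toRatFun_algebraMap_functionField]
    have hg0 : g ≠ 0 := by
      intro h0
      have h1 := (P2.mem_basicOpen f P2.zeroPoint hx).mp hxf
      have := hgy P2.zeroPoint
      rw [h0] at this
      exact (h1.map (algebraMap _ P2.functionField)).ne_zero this
    obtain ⟨c, hc⟩ : ∃ c : ℂ, functionFieldToRatFun g = algebraMap CoordRing RatFun (C c) := by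
      apply exists_eq_C_of_ord_nonneg
      intro P
      have h1 := P2.ord_le_smul (x := P.1) (U := ⊤) trivial (a := f) (by
        intro h0
        rw [hg, h0, map_zero] at hg0
        exact hg0 rfl) (1 : P2.functionField)
      rw [P2.ord_one, Algebra.smul_def, mul_one] at h1
      exact h1
    intro y
    have hc0 : c ≠ 0 := by
      rintro rfl
      rw [C_0, map_zero, map_eq_zero] at hc
      exact hg0 hc
    have hu : ∀ c : ℂ, c ≠ 0 → (C c : CoordRing) ∉ idealOf y := fun c hc h =>
      (isPrime_idealOf y).ne_top (Ideal.eq_top_of_isUnit_mem _ h ((IsUnit.mk0 c hc).map C))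
    refine P2.isUnit_of_toRatFun_eq (isHomogeneous_C _ c) (isHomogeneous_C _ 1) (hu c hc0)
      (hu 1 one_ne_zero) ?_
    rw [hgy', hc, C_1, map_one, div_one]
  have h1 : coordPoint 0 ∈ Proj.basicOpen polyGrading (X 0) :=
    hfV ((P2.mem_basicOpen f (coordPoint 0) trivial).mpr (hunit _))
  exact (Proj.mem_basicOpen _ _ _).mp h1 (Ideal.mem_span_singleton_self _)

/-- A divisor linearly equivalent to a positive multiple of a line is ample. -/
lemma isAmpleDivisor_of_pos {E : WeilDivisor P2} {m : ℕ} (hm : 1 ≤ m) {h : P2.functionField}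
    (h0 : h ≠ 0) (hE : ∀ P : PrimeDivisor P2, E P = m * coordLine 0 P + P2.ord h P.1) :
    IsAmpleDivisor E := by
  classical
  intro x
  obtain ⟨k, hk⟩ := P2.exists_X_notMem x
  have hc := pow_ne_zero m (coordRatio_ne_zero k 0)
  have hval : ∀ P : PrimeDivisor P2,
      P2.ord ((coordRatio k 0) ^ m * h⁻¹) P.1 + (1 • E) P = m * coordLine k P := by
    intro P
    rw [one_smul, P2.ord_mul hc (inv_ne_zero h0), P2.ord_inv h0, P2.ord_pow (coordRatio_ne_zero k 0),
      ord_coordRatio, hE]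
    ring
  refine ⟨1, le_rfl, (coordRatio k 0) ^ m * h⁻¹, ⟨mul_ne_zero hc (inv_ne_zero h0), fun P => ?_⟩,
    Proj.basicOpen polyGrading (X k), Proj.isAffineOpen_basicOpen polyGrading (X k)
      (isHomogeneous_X ℂ k) one_pos, ?_, (Proj.mem_basicOpen _ _ _).mpr hk⟩
  · rw [hval, coordLine_apply]
    split_ifs <;> simp
  · ext y
    refine Iff.trans (Proj.mem_basicOpen polyGrading (X k) y) (Iff.trans ?_
      Set.mem_ofPred_eq.to_iff.symm)
    change (X k : CoordRing) ∉ idealOf y ↔ _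
    simp_rw [hval]
    rw [← coordPoint_specializes_iff]
    constructor
    · intro hy P hP hPy
      rw [coordLine_apply] at hP
      split_ifs at hP with hPk
      · exact hy (hPk ▸ hPy)
      · simp at hP
    · intro hy
      refine hy (coordDivisor k) ?_
      rw [coordLine_eq_single, Finsupp.single_eq_same]
      simpa using (by omega : m ≠ 0)

/-- A principal divisor is not ample. -/
lemma not_isAmpleDivisor_of_principal {E : WeilDivisor P2} {h : P2.functionField}
    (h0 : h ≠ 0) (hE : ∀ P : PrimeDivisor P2, E P = P2.ord h P.1) : ¬ IsAmpleDivisor E := by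
  intro hample
  obtain ⟨n, -, f, ⟨hf0, hf⟩, U, hU, hUf, -⟩ := hample P2.zeroPoint
  have hval : ∀ P : PrimeDivisor P2, P2.ord f P.1 + (n • E) P = P2.ord (f * h ^ n) P.1 := by
    intro P
    rw [P2.ord_mul hf0 (pow_ne_zero n h0), P2.ord_pow h0, ← hE]
    simp
  obtain ⟨c, hc⟩ := exists_eq_C_of_ord_nonneg (f := f * h ^ n) fun P => hval P ▸ hf P
  have hU' : U = ⊤ := by
    ext y
    refine iff_of_true ?_ trivial
    rw [hUf]
    intro P hP
    rw [hval, ord_eq_zero_of_eq_C (mul_ne_zero hf0 (pow_ne_zero n h0)) hc] at hP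
    exact absurd rfl hP
  exact P2.not_isAffineOpen_top (hU' ▸ hU)

/-! ### Torus invariant divisors -/

lemma mem_idealOf_torusAction {t : Fin 3 → ℂˣ} {y : P2} {a : CoordRing} :
    a ∈ idealOf (torusAction t y) ↔ torusGradedHom t a ∈ idealOf y := Iff.rfl

lemma torusGradedHom_X (t : Fin 3 → ℂˣ) (i : Fin 3) :
    torusGradedHom t (X i : CoordRing) = C (t i : ℂ) * X i :=
  aeval_X _ _

lemma coeff_torusGradedHom (t : Fin 3 → ℂˣ) (a : CoordRing) (m : Fin 3 →₀ ℕ) :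
    coeff m (torusGradedHom t a) = (∏ i, (t i : ℂ) ^ m i) * coeff m a := by
  change coeff m (aeval (fun i => C (t i : ℂ) * X i) a) = _
  conv_lhs => rw [a.as_sum, map_sum, coeff_sum]
  have h : ∀ n : Fin 3 →₀ ℕ, aeval (fun i => C (t i : ℂ) * X i) (monomial n (coeff n a)) =
      (monomial n ((∏ i, (t i : ℂ) ^ n i) * coeff n a) : CoordRing) := by
    intro n
    rw [aeval_monomial, Finsupp.prod_fintype _ _ fun _ => pow_zero _, MvPolynomial.monomial_eq,
      Finsupp.prod_fintype _ _ fun _ => pow_zero _]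
    simp only [mul_pow, Finset.prod_mul_distrib, map_mul, map_prod, map_pow,
      MvPolynomial.algebraMap_eq]
    ring
  simp_rw [h, coeff_monomial]
  rw [Finset.sum_ite_eq']
  split_ifs with hm
  · rfl
  · rw [notMem_support_iff.mp hm, mul_zero]

lemma torusGradedHom_inv' (t : Fin 3 → ℂˣ) (p : CoordRing) :
    torusGradedHom t⁻¹ (torusGradedHom t p) = p := by
  have := torusGradedHom_inv t⁻¹ p
  rwa [inv_inv] at this

lemma torusGradedHom_isHomogeneous {t : Fin 3 → ℂˣ} {n : ℕ} {p : CoordRing} (hp : p.IsHomogeneous n) :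
    (torusGradedHom t p).IsHomogeneous n :=
  (torusGradedHom t).map_mem hp

lemma torusGradedHom_prime {t : Fin 3 → ℂˣ} {p : CoordRing} (hp : Prime p) :
    Prime (torusGradedHom t p) := by
  let e : CoordRing ≃+* CoordRing := RingEquiv.ofRingHom (torusGradedHom t).toRingHom
    (torusGradedHom t⁻¹).toRingHom (RingHom.ext (torusGradedHom_inv t))
    (RingHom.ext (torusGradedHom_inv' t))
  exact (MulEquiv.prime_iff e.toMulEquiv).mpr hp

lemma X_mem_idealOf_torusAction {t : Fin 3 → ℂˣ} {y : P2} {i : Fin 3} :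
    (X i : CoordRing) ∈ idealOf (torusAction t y) ↔ X i ∈ idealOf y := by
  rw [mem_idealOf_torusAction, torusGradedHom_X]
  exact Ideal.unit_mul_mem_iff_mem _ ((t i).isUnit.map C)

lemma isTorusInvariant_coordLine (i : Fin 3) : IsTorusInvariant (coordLine i) := by
  classical
  intro t P Q h
  rw [coordLine_apply, coordLine_apply, ← X_mem_iff_eq_coordPoint, ← X_mem_iff_eq_coordPoint]
  simp_rw [← h, X_mem_idealOf_torusAction]

lemma IsTorusInvariant.add {D E : WeilDivisor P2} (hD : IsTorusInvariant D)
    (hE : IsTorusInvariant E) : IsTorusInvariant (D + E) := fun t P Q h => by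
  rw [Finsupp.add_apply, Finsupp.add_apply, hD t P Q h, hE t P Q h]

lemma isTorusInvariant_sum_coordLine (S : Finset (Fin 3)) :
    IsTorusInvariant (∑ i ∈ S, coordLine i) :=
  Finset.sum_induction _ IsTorusInvariant (fun _ _ => IsTorusInvariant.add)
    (fun _ _ _ _ => rfl) fun i _ => isTorusInvariant_coordLine i

/-- A prime element which is not a coordinate is not a monomial. -/
lemma exists_coeff_ne_zero_of_prime {p : CoordRing} (hp : Prime p)
    (hX : ∀ i, ¬ Associated p (X i)) :
    ∃ m m' : Fin 3 →₀ ℕ, coeff m p ≠ 0 ∧ coeff m' p ≠ 0 ∧ m ≠ m' := by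
  by_contra! h
  obtain ⟨m, hm⟩ := ne_zero_iff.mp hp.ne_zero
  have hpm : p = monomial m (coeff m p) := by
    ext m'
    rw [coeff_monomial]
    split_ifs with hmm
    · rw [hmm]
    · by_contra hne
      exact hmm (h m m' hm hne)
  have hdvd : p ∣ ∏ i, (X i : CoordRing) ^ m i := by
    obtain ⟨c, hc⟩ : ∃ c, c = coeff m p := ⟨_, rfl⟩
    rw [← hc] at hpm hm
    refine ⟨C c⁻¹, ?_⟩
    rw [hpm, mul_comm, C_mul_monomial, inv_mul_cancel₀ hm, MvPolynomial.monomial_eq, C_1, one_mul,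
      Finsupp.prod_fintype _ _ (fun _ => pow_zero _)]
  obtain ⟨i, -, hi⟩ := hp.exists_mem_finset_dvd hdvd
  exact hX i ((hp.irreducible.dvd_irreducible_iff_associated (X_prime (i := i)).irreducible).mp
    (hp.dvd_of_dvd_pow hi))

/-- The element of the torus with `2 ^ k` in the `i`-th place and `1` elsewhere. -/
def dyadicTorus (i : Fin 3) (k : ℕ) : Fin 3 → ℂˣ :=
  Pi.mulSingle i (Units.mk0 (2 : ℂ) two_ne_zero ^ k)

/-- A torus invariant divisor is supported on the coordinate lines: the curve `p = 0`, with `p` not a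
monomial, has infinitely many translates, while the support is finite. -/
lemma eq_coordPoint_of_isTorusInvariant {D : WeilDivisor P2} (hD : IsTorusInvariant D)
    {P : PrimeDivisor P2} (hP : D P ≠ 0) : ∃ i, P.1 = coordPoint i := by
  obtain ⟨d, p, hp, hpd, hPp⟩ := P.exists_prime
  by_contra! hne
  have hX : ∀ i, ¬ Associated p (X i) := by
    intro i hi
    refine hne i (eq_coordPoint_of_mem ?_)
    rw [hPp, Ideal.mem_span_singleton]
    exact hi.dvd
  obtain ⟨m, m', hm, hm', hmm⟩ := exists_coeff_ne_zero_of_prime hp hX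
  obtain ⟨i, hi⟩ := Finsupp.ne_iff.mp hmm
  -- `q k = 0` is the translate of the curve `p = 0` by `dyadicTorus i k`, where `i` is an index at
  -- which the exponents of two monomials of `p` differ.
  let q : ℕ → CoordRing := fun k => torusGradedHom (dyadicTorus i k)⁻¹ p
  have hq : ∀ k, Prime (q k) := fun k => torusGradedHom_prime hp
  have hqd : ∀ k, (q k).IsHomogeneous d := fun k => torusGradedHom_isHomogeneous hpd
  let Q : ℕ → PrimeDivisor P2 := fun k =>
    ⟨P2.ofPrime (hq k) (hqd k), P2.coheight_eq_one_of_ideal_eq (hq k) rfl⟩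
  have hQ : ∀ k, torusAction (dyadicTorus i k) P.1 = (Q k).1 := by
    intro k
    apply P2.ext_ideal
    ext a
    rw [mem_idealOf_torusAction, hPp, P2.ideal_ofPrime, Ideal.mem_span_singleton,
      Ideal.mem_span_singleton]
    constructor
    · rintro ⟨c, hc⟩
      refine ⟨torusGradedHom (dyadicTorus i k)⁻¹ c, ?_⟩
      rw [← map_mul, ← hc, torusGradedHom_inv']
    · rintro ⟨c, rfl⟩
      refine ⟨torusGradedHom (dyadicTorus i k) c, ?_⟩
      rw [map_mul, torusGradedHom_inv]
  have hDQ : ∀ k, Q k ∈ D.support := fun k => by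
    rw [Finsupp.mem_support_iff, ← hD _ P (Q k) (hQ k)]
    exact hP
  obtain ⟨k, l, hkl, hQQ⟩ := Finite.exists_ne_map_eq_of_infinite
    (fun k => (⟨Q k, hDQ k⟩ : D.support))
  have hQQ : Q k = Q l := congrArg Subtype.val hQQ
  have h1 : idealOf (Q k).1 = idealOf (Q l).1 := by rw [hQQ]
  rw [P2.ideal_ofPrime, P2.ideal_ofPrime, Ideal.span_singleton_eq_span_singleton] at h1
  obtain ⟨u, hu⟩ := h1
  obtain ⟨c, hc, hcu⟩ := (MvPolynomial.isUnit_iff_eq_C_of_isReduced).mp u.isUnit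
  -- Two translates coincide, so `q k` and `q l` are proportional; compare their coefficients.
  have key : ∀ n : Fin 3 →₀ ℕ, coeff n p ≠ 0 →
      ((2 : ℂ)⁻¹ ^ k) ^ n i * c = ((2 : ℂ)⁻¹ ^ l) ^ n i := by
    intro n hn
    have h2 := congrArg (coeff n) hu
    rw [hcu, mul_comm, coeff_C_mul] at h2
    have h3 : ∀ k : ℕ, coeff n (q k) = ((2 : ℂ)⁻¹ ^ k) ^ n i * coeff n p := by
      intro k
      rw [coeff_torusGradedHom, Finset.prod_eq_single i]
      · simp [dyadicTorus]
      · intro j _ hj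
        simp [dyadicTorus, hj]
      · simp
    rw [h3, h3, ← mul_assoc] at h2
    rw [mul_comm, mul_right_cancel₀ hn h2]
  have e1 := key m hm
  have e2 := key m' hm'
  have hc0 : c ≠ 0 := hc.ne_zero
  simp only [← pow_mul] at e1 e2
  have e3 : (2 : ℂ)⁻¹ ^ (k * m i + l * m' i) = (2 : ℂ)⁻¹ ^ (k * m' i + l * m i) := by
    rw [← mul_left_inj' hc0, pow_add, pow_add, ← e1, ← e2]
    ring
  have e4 := congrArg norm e3
  rw [norm_pow, norm_pow, norm_inv, Complex.norm_two] at e4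
  have e5 := pow_right_injective₀ (by norm_num) (by norm_num) e4
  zify at e5 hi hkl
  have : ((k : ℤ) - l) * (m i - m' i) = 0 := by linarith
  rcases mul_eq_zero.mp this with h | h
  · exact hkl (by linarith)
  · exact hi (by linarith)

lemma coordPoint_injective : Function.Injective coordPoint := by
  intro i j h
  have h1 : (X i : CoordRing) ∈ idealOf (coordPoint j) :=
    h ▸ Ideal.mem_span_singleton_self (X i)
  rw [idealOf_coordPoint, Ideal.mem_span_singleton, X_dvd_X] at h1
  exact h1.symm

lemma sum_coordLine_injective :
    Function.Injective fun S : Finset (Fin 3) => ∑ i ∈ S, coordLine i := by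
  classical
  have h : ∀ (S : Finset (Fin 3)) (i : Fin 3),
      (∑ l ∈ S, coordLine l) (coordDivisor i) = if i ∈ S then 1 else 0 := by
    intro S i
    have hc : ∀ l, coordLine l (coordDivisor i) = if i = l then 1 else 0 := fun l => by
      rw [coordLine_apply]
      exact if_congr coordPoint_injective.eq_iff rfl rfl
    rw [Finsupp.finsetSum_apply]
    simp_rw [hc]
    exact Finset.sum_ite_eq S i _
  intro S T hST
  ext i
  have h1 := DFunLike.congr_fun hST (coordDivisor i)
  dsimp only at h1
  rw [h, h] at h1
  by_cases hS : i ∈ S <;> by_cases hT : i ∈ T <;> simp_all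

lemma exists_finset_of_isTorusInvariant {D : WeilDivisor P2} (hr : IsReducedDivisor D)
    (hD : IsTorusInvariant D) : ∃ S : Finset (Fin 3), D = ∑ i ∈ S, coordLine i := by
  classical
  refine ⟨Finset.univ.filter fun i => D (coordDivisor i) = 1, ?_⟩
  ext P
  rw [Finsupp.finsetSum_apply]
  by_cases hP : D P = 0
  · rw [hP, Finset.sum_eq_zero]
    intro i hi
    rw [coordLine_apply, if_neg]
    intro h
    rw [← eq_coordDivisor_iff] at h
    rw [Finset.mem_filter, ← h, hP] at hi
    simp at hi
  · obtain ⟨i, hi⟩ := eq_coordPoint_of_isTorusInvariant hD hP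
    have h1 := (hr P).resolve_left hP
    rw [Finset.sum_eq_single i, coordLine_apply, if_pos hi, h1]
    · intro j _ hj
      rw [coordLine_apply, if_neg]
      intro h
      exact hj (coordPoint_injective (h.symm.trans hi))
    · intro h
      rw [Finset.mem_filter, ← eq_coordDivisor_iff.mpr hi] at h
      simp [h1] at h

/-! ### Simple normal crossings -/

section LocalCoordinates

variable {y : P2} {k : Fin 3} (hk : (X k : CoordRing) ∉ idealOf y)

/-- The affine coordinate `xᵢ / xₖ` in the local ring of a point with `xₖ ≠ 0`. -/
def localCoord (i : Fin 3) : P2.presheaf.stalk y :=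
  (P2.exists_of_isHomogeneous y (isHomogeneous_X ℂ i) (isHomogeneous_X ℂ k) hk).choose

lemma toRatFun_localCoord (i : Fin 3) : P2.toRatFun y (localCoord hk i) =
    algebraMap CoordRing RatFun (X i) / algebraMap CoordRing RatFun (X k) :=
  (P2.exists_of_isHomogeneous y (isHomogeneous_X ℂ i) (isHomogeneous_X ℂ k) hk).choose_spec

lemma localCoord_self : localCoord hk k = 1 := by
  apply P2.toRatFun_injective
  rw [toRatFun_localCoord, map_one, div_self (algebraMap_ratFun_ne_zero (X_ne_zero k))]

lemma algebraMap_localCoord (i : Fin 3) :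
    algebraMap _ P2.functionField (localCoord hk i) = coordRatio i k := by
  apply P2.toRatFun_injective
  rw [P2.toRatFun_algebraMap_functionField, toRatFun_localCoord]
  exact (toRatFun_coordRatio i k).symm

/-- Substituting the affine coordinates into a form `a` of degree `n` gives `a / xₖ ^ n`. -/
lemma toRatFun_aeval_localCoord {n : ℕ} {a : CoordRing} (ha : a.IsHomogeneous n) :
    P2.toRatFun y (aeval (localCoord hk) a) =
      algebraMap CoordRing RatFun a / algebraMap CoordRing RatFun (X k ^ n) := by
  have hX := algebraMap_ratFun_ne_zero (X_ne_zero (R := ℂ) k)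
  rw [map_pow, eq_div_iff (pow_ne_zero n hX)]
  conv_lhs => rw [a.as_sum]
  conv_rhs => rw [a.as_sum]
  rw [map_sum, map_sum, map_sum, Finset.sum_mul]
  refine Finset.sum_congr rfl fun m hm => ?_
  have hd : ∑ i, m i = n := by
    rw [← Finsupp.degree_eq_sum, Finsupp.degree_eq_weight_one]
    exact ha (mem_support_iff.mp hm)
  rw [aeval_monomial, Finsupp.prod_fintype _ _ fun _ => pow_zero _, map_mul,
    P2.toRatFun_algebraMap, map_prod, MvPolynomial.monomial_eq,
    Finsupp.prod_fintype _ _ fun _ => pow_zero _, map_mul, map_prod, ← hd, ← Finset.prod_pow_eq_pow_sum,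
    mul_assoc, ← Finset.prod_mul_distrib]
  congr 1
  refine Finset.prod_congr rfl fun i _ => ?_
  rw [map_pow, map_pow, toRatFun_localCoord, ← mul_pow, div_mul_cancel₀ _ hX]

lemma aeval_localCoord_mem_maximalIdeal_iff {n : ℕ} {a : CoordRing} (ha : a.IsHomogeneous n) :
    aeval (localCoord hk) a ∈ IsLocalRing.maximalIdeal (P2.presheaf.stalk y) ↔ a ∈ idealOf y := by
  have hkn : (X k ^ n : CoordRing) ∉ idealOf y := 
    fun h => hk ((isPrime_idealOf y).mem_of_pow_mem _ h)
  rw [IsLocalRing.mem_maximalIdeal, mem_nonunits_iff]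
  exact ⟨P2.mem_idealOf_of_not_isUnit ha (isHomogeneous_X_pow k n) hkn
    (toRatFun_aeval_localCoord hk ha), fun h => P2.not_isUnit_of_mem h hkn
    (toRatFun_aeval_localCoord hk ha)⟩

end LocalCoordinates

lemma Fin.eq_or_eq_or_eq_of_ne {i j k : Fin 3} (hij : i ≠ j) (hik : i ≠ k) (hjk : j ≠ k)
    (l : Fin 3) : l = i ∨ l = j ∨ l = k := by
  revert i j k l
  decide

lemma Fin.univ_eq_of_ne {i j k : Fin 3} (hij : i ≠ j) (hik : i ≠ k) (hjk : j ≠ k) :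
    (Finset.univ : Finset (Fin 3)) = {i, j, k} := by
  ext l
  simpa using Fin.eq_or_eq_or_eq_of_ne hij hik hjk l

/-- A homogeneous polynomial which vanishes on the affine part of the line `xᵢ = 0` is divisible
by `xᵢ`. -/
lemma X_dvd_of_aeval_eq_zero {i j k : Fin 3} (hij : i ≠ j) (hik : i ≠ k) (hjk : j ≠ k) {n : ℕ}
    {g : CoordRing} (hg : g.IsHomogeneous n) {v : Fin 3 → Polynomial ℂ} (hvi : v i = 0)
    (hvj : v j = Polynomial.X) (hvk : v k = 1) (h : aeval v g = 0) : X i ∣ g := by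
  have huniv : (Finset.univ : Finset (Fin 3)) = {i, j, k} := Fin.univ_eq_of_ne hij hik hjk
  have hsum : ∀ m : Fin 3 →₀ ℕ, coeff m g ≠ 0 → m i + m j + m k = n := by
    intro m hm
    have : m.degree = n := by
      rw [Finsupp.degree_eq_weight_one]
      exact hg hm
    rw [Finsupp.degree_eq_sum, huniv, Finset.sum_insert (by simp [hij, hik]),
      Finset.sum_pair hjk] at this
    omega
  rw [← Ideal.mem_span_singleton, ← Set.image_singleton, mem_ideal_span_X_image]
  intro m hm
  refine ⟨i, rfl, fun hmi => ?_⟩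
  rw [mem_support_iff] at hm
  apply hm
  rw [g.as_sum, map_sum] at h
  have h1 := congrArg (Polynomial.coeff · (m j)) h
  simp only [Polynomial.finsetSum_coeff, Polynomial.coeff_zero] at h1
  have hterm : ∀ m' : Fin 3 →₀ ℕ, (aeval v (monomial m' (coeff m' g))).coeff (m j) =
      if m' i = 0 ∧ m' j = m j then coeff m' g else 0 := by
    intro m'
    rw [aeval_monomial, Finsupp.prod_fintype _ _ fun _ => pow_zero _, huniv,
      Finset.prod_insert (by simp [hij, hik]), Finset.prod_pair hjk, hvi, hvj, hvk, one_pow, mul_one,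
      Polynomial.algebraMap_eq, Polynomial.coeff_C_mul]
    by_cases hi : m' i = 0
    · simp [hi, Polynomial.coeff_X_pow, eq_comm]
    · simp [hi]
  simp_rw [hterm] at h1
  rw [Finset.sum_eq_single m, if_pos ⟨hmi, rfl⟩] at h1
  · exact h1
  · intro m' hm' hne
    rw [if_neg]
    rintro ⟨h2, h3⟩
    apply hne
    have e1 := hsum m hm
    have e2 := hsum m' (mem_support_iff.mp hm')
    ext l
    have hl : l ∈ ({i, j, k} : Finset (Fin 3)) := huniv ▸ Finset.mem_univ l
    simp only [Finset.mem_insert, Finset.mem_singleton] at hl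
    rcases hl with rfl | rfl | rfl <;> omega
  · intro h
    rw [notMem_support_iff.mp h, ite_self]

/-- A point of the line `xᵢ = 0` with `xₖ ≠ 0` is the generic point or lies on `xⱼ = c xₖ` for some
`c`: otherwise `xⱼ / xₖ` is transcendental over `ℂ` in the residue field. -/
lemma eq_coordPoint_or_exists_mem {i j k : Fin 3} (hij : i ≠ j) (hik : i ≠ k) (hjk : j ≠ k) {y : P2}
    (hi : (X i : CoordRing) ∈ idealOf y) (hk : (X k : CoordRing) ∉ idealOf y) :
    y = coordPoint i ∨ ∃ c : ℂ, (X j - C c * X k : CoordRing) ∈ idealOf y := by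
  by_contra! h
  obtain ⟨hy, hc⟩ := h
  refine hy (P2.ext_ideal (le_antisymm ?_ ?_))
  · by_contra hle
    obtain ⟨n, g, hg, hgy, hgi⟩ := P2.exists_isHomogeneous_mem hle
    let v : Fin 3 → Polynomial ℂ := fun l => if l = i then 0 else if l = k then 1 else Polynomial.X
    have hvi : v i = 0 := if_pos rfl
    have hvk : v k = 1 := by simp [v, hik.symm]
    have hvj : v j = Polynomial.X := by simp [v, hij.symm, hjk]
    let m := IsLocalRing.maximalIdeal (P2.presheaf.stalk y)
    have hG : aeval v g ≠ 0 := fun h0 => hgi <| by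
      rw [idealOf_coordPoint, Ideal.mem_span_singleton]
      exact X_dvd_of_aeval_eq_zero hij hik hjk hg hvi hvj hvk h0
    let κ := P2.presheaf.stalk y ⧸ m
    let t : κ := Ideal.Quotient.mk m (localCoord hk j)
    have hv : ∀ l, Polynomial.aeval t (v l) = Ideal.Quotient.mk m (localCoord hk l) := by
      have hl : ∀ l, l = i ∨ l = j ∨ l = k := Fin.eq_or_eq_or_eq_of_ne hij hik hjk
      intro l
      rcases hl l with rfl | rfl | rfl
      · rw [hvi, map_zero, eq_comm, Ideal.Quotient.eq_zero_iff_mem]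
        have := (aeval_localCoord_mem_maximalIdeal_iff hk (isHomogeneous_X ℂ l)).mpr hi
        rwa [aeval_X] at this
      · rw [hvj, Polynomial.aeval_X]
      · rw [hvk, map_one, localCoord_self, map_one]
    have ht : Polynomial.aeval t (aeval v g) = 0 := by
      have h1 : Ideal.Quotient.mkₐ ℂ m (aeval (localCoord hk) g) = 0 :=
        Ideal.Quotient.eq_zero_iff_mem.mpr ((aeval_localCoord_mem_maximalIdeal_iff hk hg).mpr hgy)
      rw [comp_aeval_apply] at h1 ⊢
      rw [← h1]
      congr 2
      funext l
      exact hv l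
    have halg : IsIntegral ℂ t := (isAlgebraic_iff_isIntegral).mp ⟨_, hG, ht⟩
    have hdeg := IsAlgClosed.degree_eq_one_of_irreducible ℂ (minpoly.irreducible halg)
    obtain ⟨c, hct⟩ := minpoly.mem_range_of_degree_eq_one ℂ t hdeg
    refine hc c ((aeval_localCoord_mem_maximalIdeal_iff hk (n := 1)
      ((isHomogeneous_X ℂ j).sub (isHomogeneous_C_mul_X c k))).mp ?_)
    rw [← Ideal.Quotient.eq_zero_iff_mem, map_sub, map_mul, aeval_X, aeval_X, aeval_C,
      localCoord_self, mul_one, map_sub, sub_eq_zero]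
    exact hct.symm
  · rw [idealOf_coordPoint, Ideal.span_singleton_le_iff_mem]
    exact hi

/-- Regular parameters at the closed point `xᵢ = 0`, `xⱼ = c xₖ`. -/
lemma maximalIdeal_stalk_eq_span_pair {i j k : Fin 3} (hij : i ≠ j) (hik : i ≠ k) (hjk : j ≠ k)
    {y : P2} (hi : (X i : CoordRing) ∈ idealOf y) (hk : (X k : CoordRing) ∉ idealOf y) {c : ℂ}
    (hc : (X j - C c * X k : CoordRing) ∈ idealOf y) :
    Ideal.span (Set.range ![localCoord hk i, localCoord hk j - algebraMap ℂ _ c]) =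
      IsLocalRing.maximalIdeal (P2.presheaf.stalk y) := by
  have h1 : localCoord hk i ∈ IsLocalRing.maximalIdeal (P2.presheaf.stalk y) := by
    have := (aeval_localCoord_mem_maximalIdeal_iff hk (isHomogeneous_X ℂ i)).mpr hi
    rwa [aeval_X] at this
  have h2 : localCoord hk j - algebraMap ℂ _ c ∈
      IsLocalRing.maximalIdeal (P2.presheaf.stalk y) := by
    have := (aeval_localCoord_mem_maximalIdeal_iff hk (n := 1)
      ((isHomogeneous_X ℂ j).sub (isHomogeneous_C_mul_X c k))).mpr hc
    rwa [map_sub, map_mul, aeval_X, aeval_X, aeval_C, localCoord_self, mul_one] at this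
  set I := Ideal.span (Set.range ![localCoord hk i, localCoord hk j - algebraMap ℂ _ c]) with hI
  have hIi : localCoord hk i ∈ I := Ideal.subset_span ⟨0, rfl⟩
  have hIj : localCoord hk j - algebraMap ℂ _ c ∈ I := Ideal.subset_span ⟨1, rfl⟩
  have hle : I ≤ IsLocalRing.maximalIdeal (P2.presheaf.stalk y) := by
    rw [hI, Ideal.span_le]
    rintro _ ⟨l, rfl⟩
    fin_cases l
    · exact h1
    · exact h2
  refine le_antisymm hle fun t ht => ?_
  obtain ⟨n, a, b, ha, hb, hby, hab⟩ := P2.exists_toRatFun_eq y t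
  have hay := P2.mem_idealOf_of_not_isUnit ha hb hby hab ht
  have hkn : (X k ^ n : CoordRing) ∉ idealOf y :=
    fun h => hk ((isPrime_idealOf y).mem_of_pow_mem _ h)
  obtain ⟨w, hw⟩ := P2.exists_of_isHomogeneous y (isHomogeneous_X_pow k n) hb hby
  have htw : t = aeval (localCoord hk) a * w := by
    apply P2.toRatFun_injective
    have e1 := algebraMap_ratFun_ne_zero (ne_zero_of_notMem_idealOf hkn)
    rw [map_mul, hab, hw, toRatFun_aeval_localCoord hk ha]
    field_simp
  rw [htw]
  apply I.mul_mem_right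
  let v : Fin 3 → ℂ := fun l => if l = i then 0 else if l = k then 1 else c
  -- `v` is the point `xᵢ = 0`, `xⱼ = c`, `xₖ = 1`: modulo the two parameters a form is its value there.
  have hmod : aeval (localCoord hk) a - algebraMap ℂ _ (eval v a) ∈ I := by
    rw [← Ideal.Quotient.eq_zero_iff_mem, map_sub, sub_eq_zero]
    change Ideal.Quotient.mkₐ ℂ I (aeval (localCoord hk) a) = _
    have e : algebraMap ℂ (P2.presheaf.stalk y) (eval v a) =
        aeval (fun l => algebraMap ℂ _ (v l)) a := by
      rw [← coe_aeval_eq_eval]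
      exact (aeval_algebraMap_apply _ _ _).symm
    rw [e]
    change _ = Ideal.Quotient.mkₐ ℂ I _
    rw [comp_aeval_apply, comp_aeval_apply]
    congr 2
    funext l
    have hl : ∀ l, l = i ∨ l = j ∨ l = k := Fin.eq_or_eq_or_eq_of_ne hij hik hjk
    rw [← sub_eq_zero, ← map_sub]
    refine Ideal.Quotient.eq_zero_iff_mem.mpr ?_
    rcases hl l with rfl | rfl | rfl
    · simpa [v] using hIi
    · simpa [v, hij.symm, hjk] using hIj
    · simp [v, hik.symm, localCoord_self]
  have h0 : eval v a = 0 := by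
    by_contra hne
    have e1 := (aeval_localCoord_mem_maximalIdeal_iff hk ha).mpr hay
    have e2 := (Submodule.sub_mem_iff_right _ e1).mp (hle hmod)
    exact e2 ((IsUnit.mk0 _ hne).map (algebraMap ℂ _))
  rwa [h0, map_zero, sub_zero] at hmod

lemma ringKrullDim_stalk_eq_two {i j k : Fin 3} (hij : i ≠ j) (hik : i ≠ k) (hjk : j ≠ k)
    {y : P2} (hi : (X i : CoordRing) ∈ idealOf y) (hk : (X k : CoordRing) ∉ idealOf y) {c : ℂ}
    (hc : (X j - C c * X k : CoordRing) ∈ idealOf y) :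
    ringKrullDim (P2.presheaf.stalk y) = (2 : ℕ) := by
  apply le_antisymm
  · have h := maximalIdeal_stalk_eq_span_pair hij hik hjk hi hk hc
    refine (ringKrullDim_le_spanFinrank_maximalIdeal _).trans ?_
    rw [← h]
    have := Submodule.spanFinrank_span_le_ncard_of_finite (R := P2.presheaf.stalk y)
      (Set.finite_range ![localCoord hk i, localCoord hk j - algebraMap ℂ _ c])
    have h2 : (Set.range ![localCoord hk i, localCoord hk j - algebraMap ℂ _ c]).ncard ≤ 2 := by
      rw [← Set.image_univ]
      exact (Set.ncard_image_le).trans (by simp [Set.ncard_univ])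
    exact_mod_cast this.trans h2
  · rw [ringKrullDim_stalk_eq_coheight]
    have hlt : y < coordPoint i := by
      rw [P2.lt_iff, idealOf_coordPoint]
      refine lt_of_le_of_ne ((Ideal.span_singleton_le_iff_mem _).mpr hi) fun h => ?_
      rw [← h, Ideal.mem_span_singleton] at hc
      obtain ⟨q, hq⟩ := hc
      have h1 := congrArg (eval (Pi.single j 1)) hq
      simp [hij, hjk.symm] at h1
    have h1 := Order.coheight_add_one_le hlt
    rw [coheight_coordPoint] at h1
    rw [one_add_one_eq_two] at h1
    have h2 := WithBot.coe_le_coe.mpr h1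
    exact h2

/-- Sums of coordinate lines have simple normal crossings. -/
lemma isSNCDivisor_sum_coordLine (S : Finset (Fin 3)) : IsSNCDivisor (∑ i ∈ S, coordLine i) := by
  classical
  rintro y ⟨P₀, hP₀, hP₀y⟩
  obtain ⟨i, hiS, hi⟩ : ∃ i ∈ S, (X i : CoordRing) ∈ idealOf y := by
    rw [Finsupp.finsetSum_apply] at hP₀
    obtain ⟨i, hiS, hi⟩ := Finset.exists_ne_zero_of_sum_ne_zero hP₀
    refine ⟨i, hiS, coordPoint_specializes_iff.mp ?_⟩
    rw [coordLine_apply] at hi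
    exact (ite_ne_right_iff.mp hi).1 ▸ hP₀y
  obtain ⟨k, hk⟩ := P2.exists_X_notMem y
  have hik : i ≠ k := by
    rintro rfl
    exact hk hi
  obtain ⟨j, hij, hjk⟩ : ∃ j, i ≠ j ∧ j ≠ k := by
    clear hk hi hiS
    revert i k
    decide
  -- Near `y` the divisor is cut out by `xᵢ / xₖ`, times `xⱼ / xₖ` if the line `xⱼ = 0` belongs to it.
  have hD : ∀ P : PrimeDivisor P2, P.1 ⤳ y → (∑ l ∈ S, coordLine l) P =
      P2.ord (coordRatio i k) P.1 + if j ∈ S then P2.ord (coordRatio j k) P.1 else 0 := by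
    intro P hPy
    have hkP : coordLine k P = 0 := by
      rw [coordLine_apply, if_neg]
      intro h
      exact hk (coordPoint_specializes_iff.mp (h ▸ hPy))
    rw [Finsupp.finsetSum_apply, ord_coordRatio, ord_coordRatio, hkP, sub_zero, sub_zero,
      ← Finset.univ_inter S, ← Finset.sum_ite_mem, Fin.univ_eq_of_ne hij hik hjk,
      Finset.sum_insert (by simp [hij, hik]), Finset.sum_pair hjk, if_pos hiS, hkP]
    simp
  rcases eq_coordPoint_or_exists_mem hij hik hjk hi hk with rfl | ⟨c, hc⟩
  · refine ⟨1, ![localCoord hk i], Finset.univ, ?_, ?_, fun P hPy => ?_⟩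
    · rw [ringKrullDim_stalk_eq_coheight, coheight_coordPoint]
      rfl
    · rw [maximalIdeal_stalk_eq_span X_prime (isHomogeneous_X ℂ i) (idealOf_coordPoint i)
        (isHomogeneous_X ℂ k) hk (toRatFun_localCoord hk i)]
      simp
    · rw [hD P hPy]
      have hjP : P2.ord (coordRatio j k) P.1 = 0 := by
        refine ord_eq_zero_of_notMem (isHomogeneous_X ℂ j) (isHomogeneous_X ℂ k) ?_ ?_
          (toRatFun_coordRatio j k)
        · intro h
          have h1 := (P2.specializes_iff_ideal _ _).mp hPy h
          rw [idealOf_coordPoint, Ideal.mem_span_singleton, X_dvd_X] at h1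
          exact hij h1
        · intro h
          exact hk ((P2.specializes_iff_ideal _ _).mp hPy h)
      rw [hjP, ite_self, add_zero]
      simp [algebraMap_localCoord]
  · have hdim := ringKrullDim_stalk_eq_two hij hik hjk hi hk hc
    have hspan := maximalIdeal_stalk_eq_span_pair hij hik hjk hi hk hc
    by_cases hj : c = 0 ∧ j ∈ S
    · obtain ⟨rfl, hjS⟩ := hj
      refine ⟨2, _, Finset.univ, hdim, hspan, fun P hPy => ?_⟩
      rw [hD P hPy, if_pos hjS, Fin.prod_univ_two]
      simp only [Matrix.cons_val_zero, Matrix.cons_val_one, map_zero, sub_zero, map_mul,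
        algebraMap_localCoord]
      rw [P2.ord_mul (coordRatio_ne_zero i k) (coordRatio_ne_zero j k)]
    · refine ⟨2, _, {0}, hdim, hspan, fun P hPy => ?_⟩
      have hjP : (if j ∈ S then P2.ord (coordRatio j k) P.1 else 0) = 0 := by
        rw [ite_eq_right_iff]
        intro hjS
        refine ord_eq_zero_of_notMem (isHomogeneous_X ℂ j) (isHomogeneous_X ℂ k) ?_ ?_
          (toRatFun_coordRatio j k)
        · intro h
          have h1 := (P2.specializes_iff_ideal _ _).mp hPy h
          have h2 : (C c * X k : CoordRing) ∈ idealOf y :=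
            (Submodule.sub_mem_iff_right _ h1).mp hc
          refine hj ⟨by_contra fun hc0 => hk ?_, hjS⟩
          exact (Ideal.unit_mul_mem_iff_mem _ ((IsUnit.mk0 c hc0).map C)).mp h2
        · intro h
          exact hk ((P2.specializes_iff_ideal _ _).mp hPy h)
      rw [hD P hPy, hjP, add_zero, Finset.prod_singleton]
      simp only [Matrix.cons_val_zero, algebraMap_localCoord]

/-! ### Differentials and canonical divisors -/

section Chart

variable {i j k : Fin 3} {y : P2} (hk : (X k : CoordRing) ∉ idealOf y)

/-- The map from the coordinate ring `ℂ[u, v]` of the chart `xₖ ≠ 0` to the local ring at `y`, with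
`u ↦ xᵢ / xₖ` and `v ↦ xⱼ / xₖ`. -/
def chartHom (i j : Fin 3) : MvPolynomial (Fin 2) ℂ →ₐ[ℂ] P2.presheaf.stalk y :=
  aeval ![localCoord hk i, localCoord hk j]

/-- Dehomogenization with respect to the third variable `xₖ`: `xᵢ ↦ u`, `xⱼ ↦ v` and `xₖ ↦ 1`. -/
def dehomogenize (i j : Fin 3) : CoordRing →ₐ[ℂ] MvPolynomial (Fin 2) ℂ :=
  aeval fun l => if l = i then X 0 else if l = j then X 1 else 1

lemma dehomogenize_X_left (i j : Fin 3) : dehomogenize i j (X i) = X 0 := by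
  simp [dehomogenize]

lemma dehomogenize_X_right (hij : i ≠ j) : dehomogenize i j (X j) = X 1 := by
  simp [dehomogenize, hij.symm]

lemma dehomogenize_X_of_ne (hik : i ≠ k) (hjk : j ≠ k) : dehomogenize i j (X k) = 1 := by
  simp [dehomogenize, hik.symm, hjk.symm]

lemma chartHom_dehomogenize (hij : i ≠ j) (hik : i ≠ k) (hjk : j ≠ k) (a : CoordRing) :
    chartHom hk i j (dehomogenize i j a) = aeval (localCoord hk) a := by
  change ((chartHom hk i j).comp (dehomogenize i j)) a = _
  congr 1
  ext l
  rw [AlgHom.comp_apply, aeval_X]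
  rcases Fin.eq_or_eq_or_eq_of_ne hij hik hjk l with rfl | rfl | rfl
  · rw [dehomogenize_X_left, chartHom, aeval_X]
    rfl
  · rw [dehomogenize_X_right hij, chartHom, aeval_X]
    rfl
  · rw [dehomogenize_X_of_ne hik hjk, map_one, localCoord_self]

lemma exists_homogenization (hij : i ≠ j) (hik : i ≠ k) (hjk : j ≠ k)
    (f : MvPolynomial (Fin 2) ℂ) : ∃ N, ∀ n, N ≤ n →
      ∃ g : CoordRing, g.IsHomogeneous n ∧ dehomogenize i j g = f := by
  induction f using MvPolynomial.induction_on with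
  | C c =>
    refine ⟨0, fun n _ => ⟨C c * X k ^ n, (isHomogeneous_X_pow k n).C_mul c, ?_⟩⟩
    rw [map_mul, map_pow, dehomogenize_X_of_ne hik hjk, one_pow, mul_one, ← algebraMap_eq,
      AlgHom.commutes, algebraMap_eq]
  | add f₁ f₂ h₁ h₂ =>
    obtain ⟨N₁, h₁⟩ := h₁
    obtain ⟨N₂, h₂⟩ := h₂
    refine ⟨max N₁ N₂, fun n hn => ?_⟩
    obtain ⟨g₁, hg₁, rfl⟩ := h₁ n ((le_max_left _ _).trans hn)
    obtain ⟨g₂, hg₂, rfl⟩ := h₂ n ((le_max_right _ _).trans hn)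
    exact ⟨g₁ + g₂, hg₁.add hg₂, map_add _ _ _⟩
  | mul_X f l h =>
    obtain ⟨N, h⟩ := h
    refine ⟨N + 1, fun n hn => ?_⟩
    obtain ⟨n, rfl⟩ : ∃ n', n = n' + 1 := ⟨n - 1, by omega⟩
    obtain ⟨g, hg, rfl⟩ := h n (by omega)
    obtain ⟨l', hl'⟩ : ∃ l', dehomogenize i j (X l') = X l := by
      fin_cases l
      · exact ⟨i, dehomogenize_X_left i j⟩
      · exact ⟨j, dehomogenize_X_right hij⟩
    exact ⟨g * X l', hg.mul (isHomogeneous_X ℂ l'), by rw [map_mul, hl']⟩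

lemma chartHom_injective (hij : i ≠ j) (hik : i ≠ k) (hjk : j ≠ k) :
    Function.Injective (chartHom hk i j) := by
  rw [injective_iff_map_eq_zero]
  intro f hf
  obtain ⟨n, hn⟩ := exists_homogenization hij hik hjk f
  obtain ⟨g, hg, rfl⟩ := hn n le_rfl
  rw [chartHom_dehomogenize hk hij hik hjk] at hf
  have h := toRatFun_aeval_localCoord hk hg
  rw [hf, map_zero, eq_comm, div_eq_zero_iff, or_iff_left
    (algebraMap_ratFun_ne_zero (pow_ne_zero n (X_ne_zero k))),
    FaithfulSMul.algebraMap_eq_zero_iff] at h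
  rw [h, map_zero]

/-- The local ring at `y` is the localization of `ℂ[u, v]` at the elements that become units. -/
lemma isLocalization_chartHom (hij : i ≠ j) (hik : i ≠ k) (hjk : j ≠ k) :
    letI := (chartHom hk i j).toAlgebra
    IsLocalization ((IsUnit.submonoid (P2.presheaf.stalk y)).comap (chartHom hk i j))
      (P2.presheaf.stalk y) := by
  let := (chartHom hk i j).toAlgebra
  have hmap : ∀ f, algebraMap (MvPolynomial (Fin 2) ℂ) (P2.presheaf.stalk y) f =
    chartHom hk i j f := fun _ => rfl
  constructor
  constructor
  · intro f
    exact f.2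
  · intro t
    obtain ⟨n, a, b, ha, hb, hby, hab⟩ := P2.exists_toRatFun_eq y t
    have hkn : (X k ^ n : CoordRing) ∉ idealOf y :=
      fun h => hk ((isPrime_idealOf y).mem_of_pow_mem _ h)
    refine ⟨⟨dehomogenize i j a, ⟨dehomogenize i j b, ?_⟩⟩, ?_⟩
    · change IsUnit (chartHom hk i j _)
      rw [chartHom_dehomogenize hk hij hik hjk]
      exact P2.isUnit_of_toRatFun_eq hb (isHomogeneous_X_pow k n) hby hkn
        (toRatFun_aeval_localCoord hk hb)
    · rw [hmap, hmap]
      dsimp only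
      rw [chartHom_dehomogenize hk hij hik hjk, chartHom_dehomogenize hk hij hik hjk]
      apply P2.toRatFun_injective
      have e1 := algebraMap_ratFun_ne_zero (ne_zero_of_notMem_idealOf hby)
      rw [map_mul, hab, toRatFun_aeval_localCoord hk ha, toRatFun_aeval_localCoord hk hb]
      field_simp
  · intro f g hfg
    exact ⟨1, by rw [chartHom_injective hk hij hik hjk hfg]⟩

open scoped KaehlerDifferential in
/-- The differentials of the affine coordinates form a basis of the differentials of the local
ring. -/
lemma exists_basis_kaehlerDifferential (hij : i ≠ j) (hik : i ≠ k) (hjk : j ≠ k) :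
    ∃ b : Module.Basis (Fin 2) (P2.presheaf.stalk y) Ω[P2.presheaf.stalk y⁄ℂ],
      ∀ l, b l = KaehlerDifferential.D ℂ (P2.presheaf.stalk y)
        (![localCoord hk i, localCoord hk j] l) := by
  let := (chartHom hk i j).toAlgebra
  have : IsScalarTower ℂ (MvPolynomial (Fin 2) ℂ) (P2.presheaf.stalk y) :=
    IsScalarTower.of_algebraMap_eq fun c => ((chartHom hk i j).commutes c).symm
  have := isLocalization_chartHom hk hij hik hjk
  refine ⟨(KaehlerDifferential.mvPolynomialBasis ℂ (Fin 2)).ofIsLocalizedModule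
    (P2.presheaf.stalk y) ((IsUnit.submonoid (P2.presheaf.stalk y)).comap (chartHom hk i j))
    (KaehlerDifferential.map ℂ ℂ (MvPolynomial (Fin 2) ℂ) (P2.presheaf.stalk y)), fun l => ?_⟩
  rw [Module.Basis.ofIsLocalizedModule_apply, KaehlerDifferential.mvPolynomialBasis_apply,
    KaehlerDifferential.map_D]
  congr 1
  exact aeval_X _ _

end Chart

instance isScalarTower_functionField (y : P2) :
    IsScalarTower ℂ (P2.presheaf.stalk y) P2.functionField :=
  IsScalarTower.of_algebraMap_eq fun c => P2.toRatFun_injective _ <| by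
    rw [P2.toRatFun_algebraMap_functionField, P2.toRatFun_algebraMap, P2.toRatFun_algebraMap]

lemma AlternatingMap.map_fin_two_eq_det_smul {R M N : Type*} [CommRing R] [AddCommGroup M]
    [AddCommGroup N] [Module R M] [Module R N] (f : M [⋀^Fin 2]→ₗ[R] N) (v : Fin 2 → M)
    (A : Matrix (Fin 2) (Fin 2) R) : f (fun i => ∑ j, A i j • v j) = A.det • f v := by
  have hv : v = ![v 0, v 1] := by ext i; fin_cases i <;> rfl
  have h : (fun i => ∑ j, A i j • v j) =
      ![A 0 0 • v 0 + A 0 1 • v 1, A 1 0 • v 0 + A 1 1 • v 1] := by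
    ext i; fin_cases i <;> simp [Fin.sum_univ_two]
  have h00 : ∀ a : M, f ![a, a] = 0 := fun a =>
    f.map_eq_zero_of_eq _ (i := 0) (j := 1) rfl (by decide)
  have h10 : f ![v 1, v 0] = - f ![v 0, v 1] := by
    rw [← f.map_swap _ (i := 0) (j := 1) (by decide)]
    congr 1
    ext i; fin_cases i <;> rfl
  have h1 : ∀ (a b : M) (w : Fin 1 → M), f (Matrix.vecCons (a + b) w) =
      f (Matrix.vecCons a w) + f (Matrix.vecCons b w) := fun a b w =>
    f.toMultilinearMap.cons_add w a b
  have h2 : ∀ (c : R) (a : M) (w : Fin 1 → M), f (Matrix.vecCons (c • a) w) =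
      c • f (Matrix.vecCons a w) := fun c a w => f.toMultilinearMap.cons_smul w c a
  have h3 : ∀ x a b : M, f ![x, a + b] = f ![x, a] + f ![x, b] := by
    intro x a b
    have e : ∀ z, ![x, z] = Function.update ![x, 0] 1 z := fun z => by
      ext i; fin_cases i <;> rfl
    rw [e (a + b), e a, e b, f.map_update_add]
  have h4 : ∀ (x : M) (c : R) (a : M), f ![x, c • a] = c • f ![x, a] := by
    intro x c a
    have e : ∀ z, ![x, z] = Function.update ![x, 0] 1 z := fun z => by
      ext i; fin_cases i <;> rfl
    rw [e (c • a), e a, f.map_update_smul]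
  rw [h, hv, Matrix.det_fin_two]
  simp only [h1, h2, h3, h4, h00, h10, Matrix.cons_val_zero, Matrix.cons_val_one]
  module

open scoped KaehlerDifferential

/-- Rational 2-forms. -/
abbrev RationalForm : Type := ⋀[P2.functionField]^2 Ω[P2.functionField⁄ℂ]

/-- The rational 2-form `du₀ ∧ du₁`. -/
def wedge (u : Fin 2 → P2.functionField) : RationalForm :=
  exteriorPower.ιMulti P2.functionField 2 fun i => KaehlerDifferential.D ℂ P2.functionField (u i)

/-- If `du₀, du₁` span the differentials of the local ring, then every `dw₀ ∧ dw₁` is a regular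
multiple of `du₀ ∧ du₁`. -/
lemma exists_wedge_eq_smul {y : P2} {u : Fin 2 → P2.presheaf.stalk y}
    (hu : Submodule.span (P2.presheaf.stalk y)
      (Set.range fun i => KaehlerDifferential.D ℂ (P2.presheaf.stalk y) (u i)) = ⊤)
    (w : Fin 2 → P2.presheaf.stalk y) : ∃ r : P2.presheaf.stalk y,
      wedge (fun i => algebraMap _ P2.functionField (w i)) =
        algebraMap _ P2.functionField r • wedge (fun i => algebraMap _ P2.functionField (u i)) := by
  have h : ∀ l, ∃ c : Fin 2 → P2.presheaf.stalk y,
      ∑ m, c m • KaehlerDifferential.D ℂ (P2.presheaf.stalk y) (u m) =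
        KaehlerDifferential.D ℂ (P2.presheaf.stalk y) (w l) := fun l =>
    (Submodule.mem_span_range_iff_exists_fun _).mp (hu ▸ Submodule.mem_top)
  choose A hA using h
  refine ⟨(Matrix.of A).det, ?_⟩
  rw [RingHom.map_det, wedge, wedge, ← AlternatingMap.map_fin_two_eq_det_smul]
  congr 1
  funext l
  have := congrArg (KaehlerDifferential.map ℂ ℂ (P2.presheaf.stalk y) P2.functionField) (hA l)
  rw [KaehlerDifferential.map_D, map_sum] at this
  rw [← this]
  refine Finset.sum_congr rfl fun m _ => ?_
  rw [map_smul, KaehlerDifferential.map_D, algebra_compatible_smul P2.functionField]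
  rfl

/-- The rational 2-form `d(xᵢ / xₖ) ∧ d(xⱼ / xₖ)`. -/
def chartForm (i j k : Fin 3) : RationalForm := wedge ![coordRatio i k, coordRatio j k]

lemma wedge_localCoord {i j k : Fin 3} {y : P2} (hk : (X k : CoordRing) ∉ idealOf y) :
    wedge (fun l => algebraMap _ P2.functionField (![localCoord hk i, localCoord hk j] l)) =
      chartForm i j k := by
  rw [chartForm]
  congr 1
  funext l
  fin_cases l <;> exact algebraMap_localCoord hk _

section

variable {i j k : Fin 3} (hij : i ≠ j) (hik : i ≠ k) (hjk : j ≠ k)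
include hij hik hjk

lemma exists_basis_functionField : ∃ b : Module.Basis (Fin 2) P2.functionField
    Ω[P2.functionField⁄ℂ], ∀ l, b l = KaehlerDifferential.D ℂ P2.functionField
      (![coordRatio i k, coordRatio j k] l) := by
  have hk : (X k : CoordRing) ∉ idealOf (genericPoint P2) := by
    rw [P2.genericPoint_eq]
    exact X_ne_zero k
  have h : ∀ l, localCoord hk l = coordRatio l k := fun l => P2.toRatFun_injective _ <| by
    rw [toRatFun_localCoord]
    exact (toRatFun_coordRatio l k).symm
  obtain ⟨b, hb⟩ := exists_basis_kaehlerDifferential hk hij hik hjk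
  refine ⟨b, fun l => ?_⟩
  rw [hb, h, h]

lemma chartForm_ne_zero : chartForm i j k ≠ 0 := by
  obtain ⟨b, hb⟩ := exists_basis_functionField hij hik hjk
  intro h
  have h1 := congrArg (exteriorPower.alternatingMapLinearEquiv b.det) h
  rw [chartForm, wedge, exteriorPower.alternatingMapLinearEquiv_apply_ιMulti, map_zero] at h1
  simp_rw [← hb] at h1
  exact one_ne_zero (b.det_self.symm.trans h1)

lemma exists_eq_smul_chartForm (ω : RationalForm) :
    ∃ h : P2.functionField, ω = h • chartForm i j k := by
  obtain ⟨b, hb⟩ := exists_basis_functionField hij hik hjk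
  have hω : ω ∈ Submodule.span P2.functionField (Set.range
      (exteriorPower.ιMulti P2.functionField 2 (M := Ω[P2.functionField⁄ℂ]))) := by
    rw [exteriorPower.ιMulti_span]
    trivial
  have hle : Submodule.span P2.functionField (Set.range
      (exteriorPower.ιMulti P2.functionField 2 (M := Ω[P2.functionField⁄ℂ]))) ≤
      Submodule.span P2.functionField {chartForm i j k} := by
    rw [Submodule.span_le]
    rintro _ ⟨v, rfl⟩
    rw [SetLike.mem_coe, Submodule.mem_span_singleton]
    refine ⟨(Matrix.of fun l => b.repr (v l)).det, ?_⟩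
    rw [chartForm, wedge, ← AlternatingMap.map_fin_two_eq_det_smul]
    congr 1
    funext l
    simp_rw [← hb]
    exact b.sum_repr (v l)
  obtain ⟨h, hh⟩ := Submodule.mem_span_singleton.mp (hle hω)
  exact ⟨h, hh.symm⟩

end

/-- Change of chart: with `s = xᵢ / xₖ` and `w = xⱼ / xₖ`, one has `d(1/s) ∧ d(w/s) = -s⁻³ ds ∧ dw`. -/
lemma chartForm_eq_smul_chartForm (i j k : Fin 3) :
    chartForm k j i = -(coordRatio i k)⁻¹ ^ 3 • chartForm i j k := by
  set s := coordRatio i k with hs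
  set w := coordRatio j k with hw
  have hs0 : s ≠ 0 := coordRatio_ne_zero i k
  have hX : ∀ l : Fin 3, algebraMap CoordRing RatFun (X l) ≠ 0 :=
    fun l => algebraMap_ratFun_ne_zero (X_ne_zero l)
  have h1 : coordRatio k i = s⁻¹ := P2.toRatFun_injective _ <| by
    rw [map_inv₀, toRatFun_coordRatio, toRatFun_coordRatio, inv_div]
  have h2 : coordRatio j i = w * s⁻¹ := P2.toRatFun_injective _ <| by
    rw [map_mul, map_inv₀, toRatFun_coordRatio, toRatFun_coordRatio, toRatFun_coordRatio, inv_div,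
      div_mul_div_cancel₀ (hX k)]
  have h3 : -s⁻¹ ^ 3 = (!![-s⁻¹ ^ 2, 0; -w * s⁻¹ ^ 2, s⁻¹] : Matrix _ _ _).det := by
    rw [Matrix.det_fin_two_of]
    ring
  rw [h3, chartForm, chartForm, wedge, wedge, ← AlternatingMap.map_fin_two_eq_det_smul, h1, h2]
  congr 1
  funext l
  have h4 : KaehlerDifferential.D ℂ P2.functionField s⁻¹ =
      -s⁻¹ ^ 2 • KaehlerDifferential.D ℂ P2.functionField s :=
    Derivation.leibniz_inv _ s
  fin_cases l
  · simp [Fin.sum_univ_two, h4]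
    rfl
  · simp [Fin.sum_univ_two, h4, smul_smul]
    module

/-- The form `d(x₁ / x₀) ∧ d(x₂ / x₀)` has a pole of order three along `x₀ = 0` and neither zeros nor
other poles. -/
lemma exists_local_generator (P : PrimeDivisor P2) :
    ∃ (u : Fin 2 → P2.presheaf.stalk P.1) (f : P2.functionField),
      LinearIndependent (P2.presheaf.stalk P.1)
        (fun i => KaehlerDifferential.D ℂ (P2.presheaf.stalk P.1) (u i)) ∧
      Submodule.span (P2.presheaf.stalk P.1)
        (Set.range fun i => KaehlerDifferential.D ℂ (P2.presheaf.stalk P.1) (u i)) = ⊤ ∧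
      chartForm 1 2 0 = f • wedge (fun i => algebraMap _ P2.functionField (u i)) ∧ f ≠ 0 ∧
      P2.ord f P.1 = -3 * coordLine 0 P := by
  classical
  have key : ∀ {i j k : Fin 3} (hij : i ≠ j) (hik : i ≠ k) (hjk : j ≠ k) {y : P2}
      (hk : (X k : CoordRing) ∉ idealOf y), ∃ u : Fin 2 → P2.presheaf.stalk y,
      LinearIndependent (P2.presheaf.stalk y)
        (fun i => KaehlerDifferential.D ℂ (P2.presheaf.stalk y) (u i)) ∧
      Submodule.span (P2.presheaf.stalk y)
        (Set.range fun i => KaehlerDifferential.D ℂ (P2.presheaf.stalk y) (u i)) = ⊤ ∧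
      chartForm i j k = wedge (fun i => algebraMap _ P2.functionField (u i)) := by
    intro i j k hij hik hjk y hk
    obtain ⟨b, hb⟩ := exists_basis_kaehlerDifferential hk hij hik hjk
    have hb' := funext hb
    refine ⟨_, ?_, ?_, (wedge_localCoord (i := i) (j := j) hk).symm⟩
    · rw [← hb']
      exact b.linearIndependent
    · rw [← hb']
      exact b.span_eq
  by_cases hP : P.1 = coordPoint 0
  · have h1 : (X 1 : CoordRing) ∉ idealOf P.1 := by
      rw [hP, idealOf_coordPoint, Ideal.mem_span_singleton, X_dvd_X]
      decide
    obtain ⟨u, hu, hu', huw⟩ := key (i := 0) (j := 2) (k := 1) (by decide) (by decide) (by decide) h1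
    have h0 := coordRatio_ne_zero 0 1
    have h0' := inv_ne_zero h0
    refine ⟨u, -(coordRatio 0 1)⁻¹ ^ 3, hu, hu', ?_, neg_ne_zero.mpr (pow_ne_zero 3 h0'), ?_⟩
    · rw [← huw]
      exact chartForm_eq_smul_chartForm 0 2 1
    · have hneg : P2.ord (-1 : P2.functionField) P.1 = 0 := by
        have := P2.ord_algebraMap_of_isUnit P.1 (-1) isUnit_one.neg
        rwa [map_neg, map_one] at this
      rw [neg_eq_neg_one_mul, P2.ord_mul (neg_ne_zero.mpr one_ne_zero) (pow_ne_zero 3 h0'), hneg,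
        P2.ord_pow h0', P2.ord_inv h0, ord_coordRatio, coordLine_apply 1, if_neg]
      · push_cast
        ring
      · rwa [X_mem_iff_eq_coordPoint] at h1
  · have h0 : (X 0 : CoordRing) ∉ idealOf P.1 := X_mem_iff_eq_coordPoint.not.mpr hP
    obtain ⟨u, hu, hu', huw⟩ := key (i := 1) (j := 2) (k := 0) (by decide) (by decide) (by decide) h0
    refine ⟨u, 1, hu, hu', by rw [one_smul, huw], one_ne_zero, ?_⟩
    rw [P2.ord_one, coordLine_apply, if_neg hP, mul_zero]

/-- `-3 D₀` is a canonical divisor. -/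
lemma isCanonicalDivisor_neg_three : IsCanonicalDivisor (-3 • coordLine 0) := by
  refine ⟨chartForm 1 2 0, chartForm_ne_zero (by decide) (by decide) (by decide), fun P => ?_⟩
  obtain ⟨u, f, hu, hu', hf, -, hord⟩ := exists_local_generator P
  refine ⟨u, f, hu, hu', hf, ?_⟩
  rw [hord]
  simp

/-- Every canonical divisor is linearly equivalent to `-3 D₀`. -/
lemma IsCanonicalDivisor.exists_eq {K : WeilDivisor P2} (hK : IsCanonicalDivisor K) :
    ∃ h : P2.functionField, h ≠ 0 ∧
      ∀ P : PrimeDivisor P2, K P = P2.ord h P.1 - 3 * coordLine 0 P := by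
  obtain ⟨ω, hω, hK⟩ := hK
  obtain ⟨h, rfl⟩ := exists_eq_smul_chartForm (i := 1) (j := 2) (k := 0) (by decide) (by decide)
    (by decide) ω
  have h0 : h ≠ 0 := by
    rintro rfl
    exact hω (zero_smul _ _)
  refine ⟨h, h0, fun P => ?_⟩
  obtain ⟨u', f', -, hu', hf', hord'⟩ := hK P
  obtain ⟨u, f, -, hu, hf, hf0, hord⟩ := exists_local_generator P
  change h • chartForm 1 2 0 = f' • wedge (fun i => algebraMap _ P2.functionField (u' i)) at hf'
  have hf'0 : f' ≠ 0 := by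
    rintro rfl
    exact hω (hf'.trans (zero_smul _ _))
  obtain ⟨r, hr⟩ := exists_wedge_eq_smul hu u'
  obtain ⟨r', hr'⟩ := exists_wedge_eq_smul hu' u
  have hw : wedge (fun i => algebraMap _ P2.functionField (u i)) ≠ 0 := by
    intro h
    rw [h, smul_zero] at hf
    exact chartForm_ne_zero (by decide) (by decide) (by decide) hf
  -- Two bases of the differentials differ by an invertible determinant.
  have hrr : IsUnit r := by
    refine IsUnit.of_mul_eq_one r' (IsFractionRing.injective _ P2.functionField ?_)
    rw [hr, smul_smul] at hr'
    rw [map_mul, map_one, mul_comm]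
    exact (smul_left_injective _ hw ((one_smul _ _).trans hr')).symm
  rw [hf, hr, smul_smul, smul_smul] at hf'
  have hmul : P2.ord (h * f) P.1 = P2.ord (f' * algebraMap _ P2.functionField r) P.1 :=
    congrArg (fun g => P2.ord g P.1) (smul_left_injective _ hw hf')
  have hr0 : algebraMap _ P2.functionField r ≠ 0 := (hrr.map _).ne_zero
  rw [P2.ord_mul h0 hf0, P2.ord_mul hf'0 hr0, P2.ord_algebraMap_of_isUnit _ _ hrr, hord] at hmul
  rw [hord']
  linarith

/-- For a sum `D` of coordinate lines, `-(K + D)` is linearly equivalent to `3 - |S|` times a line. -/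
lemma isAmpleDivisor_neg_add_sum_coordLine_iff {K : WeilDivisor P2} (hK : IsCanonicalDivisor K)
    (S : Finset (Fin 3)) : IsAmpleDivisor (-(K + ∑ i ∈ S, coordLine i)) ↔ S ≠ Finset.univ := by
  obtain ⟨h, h0, hK⟩ := hK.exists_eq
  have hprod : ∏ i ∈ S, coordRatio i 0 ≠ 0 :=
    Finset.prod_ne_zero_iff.mpr fun i _ => coordRatio_ne_zero i 0
  have hcard : S.card ≤ 3 := by simpa using Finset.card_le_univ S
  have hg : (h * ∏ i ∈ S, coordRatio i 0)⁻¹ ≠ 0 := inv_ne_zero (mul_ne_zero h0 hprod)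
  have hval : ∀ P : PrimeDivisor P2, (-(K + ∑ i ∈ S, coordLine i)) P =
      ((3 - S.card : ℕ) : ℤ) * coordLine 0 P + P2.ord (h * ∏ i ∈ S, coordRatio i 0)⁻¹ P.1 := by
    intro P
    rw [P2.ord_inv (mul_ne_zero h0 hprod), P2.ord_mul h0 hprod,
      P2.ord_prod _ _ fun i _ => coordRatio_ne_zero i 0]
    simp only [ord_coordRatio, Finset.sum_sub_distrib, Finset.sum_const, Finsupp.neg_apply,
      Finsupp.add_apply, Finsupp.finsetSum_apply, hK, nsmul_eq_mul]
    push_cast [hcard]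
    ring
  constructor
  · rintro hample rfl
    refine not_isAmpleDivisor_of_principal hg (fun P => ?_) hample
    rw [hval]
    simp
  · intro hS
    refine isAmpleDivisor_of_pos ?_ hg hval
    have := (Finset.card_lt_iff_ne_univ S).mpr hS
    simp at this
    omega

end

theorem theorem1p2 :
    (∃ K : WeilDivisor P2, IsCanonicalDivisor K) ∧
    ∀ K : WeilDivisor P2, IsCanonicalDivisor K →
      (∀ D : WeilDivisor P2, IsReducedDivisor D → D ≠ 0 →
        (IsToricLogDelPezzo K D ↔
          D ∈ ({coordLine 0, coordLine 1, coordLine 2} ∪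
            {coordLine 0 + coordLine 1, coordLine 0 + coordLine 2, coordLine 1 + coordLine 2} :
            Set (WeilDivisor P2)))) ∧
      (∀ D : WeilDivisor P2, IsReducedDivisor D → IsTorusInvariant D →
        (¬ IsAmpleDivisor (-(K + D)) ↔ D = coordLine 0 + coordLine 1 + coordLine 2)) := by
  have huniv : ∑ i, coordLine i = coordLine 0 + coordLine 1 + coordLine 2 := Fin.sum_univ_three _
  have hsub : ∀ S : Finset (Fin 3), S ≠ Finset.univ → S ≠ ∅ →
      S = {0} ∨ S = {1} ∨ S = {2} ∨ S = {0, 1} ∨ S = {0, 2} ∨ S = {1, 2} := by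
    decide
  refine ⟨⟨_, isCanonicalDivisor_neg_three⟩,
    fun K hK => ⟨fun D hr hD => ⟨?_, ?_⟩, fun D hr hT => ?_⟩⟩
  · rintro ⟨-, hT, hample⟩
    obtain ⟨S, rfl⟩ := exists_finset_of_isTorusInvariant hr hT
    have hS := (isAmpleDivisor_neg_add_sum_coordLine_iff hK S).mp hample
    have hS' : S ≠ ∅ := by
      rintro rfl
      exact hD Finset.sum_empty
    rcases hsub S hS hS' with rfl | rfl | rfl | rfl | rfl | rfl <;>
      simp
  · intro hmem
    obtain ⟨S, hS, rfl⟩ : ∃ S : Finset (Fin 3), S ≠ Finset.univ ∧ D = ∑ i ∈ S, coordLine i := by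
      rcases hmem with (rfl | rfl | rfl) | (rfl | rfl | rfl)
      · exact ⟨{0}, by decide, by simp⟩
      · exact ⟨{1}, by decide, by simp⟩
      · exact ⟨{2}, by decide, by simp⟩
      · exact ⟨{0, 1}, by decide, by simp⟩
      · exact ⟨{0, 2}, by decide, by simp⟩
      · exact ⟨{1, 2}, by decide, by simp⟩
    exact ⟨isSNCDivisor_sum_coordLine S, isTorusInvariant_sum_coordLine S,
      (isAmpleDivisor_neg_add_sum_coordLine_iff hK S).mpr hS⟩
  · obtain ⟨S, rfl⟩ := exists_finset_of_isTorusInvariant hr hT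
    rw [isAmpleDivisor_neg_add_sum_coordLine_iff hK, not_not, ← huniv]
    exact sum_coordLine_injective.eq_iff.symm
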